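/- All Hilbert spaces are finite-dimensional. A quantum channel is a completely positive trace-preserving linear map $\Phi$ from the operators on $\mathcal H_A$ to those on $\mathcal H_B$. If $V:\mathcal H_A\to\mathcal H_B\otimes\mathcal H_E$ is an isometry with $\Phi(\rho)=\mathrm{Tr}_{\mathcal H_E}V\rho V^*$, then $\widehat\Phi(\rho)=\mathrm{Tr}_{\mathcal H_B}V\rho V^*$ is a complementary channel, and $\mathcal G(\Phi)=\widehat\Phi^*(\mathfrak B(\mathcal H_E))$ (which does not depend on $V$) is the noncommutative graph of $\Phi$. A subspace $\mathcal H_0\subseteq\mathcal H_A$ is an error correcting code for $\Phi$ if there is a channel $\Theta$ with $\Theta(\Phi(\rho))=\rho$ for all states $\rho$ supported by $\mathcal H_0$. The 1-shot quantum zero-error capacity $\bar Q_0(\Phi)$ is the supremum of $\log_2\dim\mathcal H_0$ over all nonzero error correcting codes $\mathcal H_0$ for $\Phi$, and $Q_0(\Phi)=\sup_{n\ge1}n^{-1}\bar Q_0(\Phi^{\otimes n})$. Let $p\ge 2$ be an integer. Let $\mathfrak L^p_0=\mathfrak A_2^{\otimes p}\subseteq\mathfrak M_{2^p}$, where $\mathfrak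 A_2=\left\{\begin{bmatrix}a&b\\b&a\end{bmatrix}: a,b\in\mathbb C\right\}$; recursively, $\mathfrak L^1_0=\mathfrak A_2$ and $\mathfrak L^p_0=\left\{\begin{bmatrix}A&B\\B&A\end{bmatrix}: A,B\in\mathfrak L^{p-1}_0\right\}$. For $\theta\in(-\pi,\pi]$ put $\gamma=\exp(\frac{\mathrm i}{2}\theta)$ and let $D(\theta)$ be the $2^p\times2^p$ matrix consisting of the $2\times2$ blocks $A_{ij}$, $1\le i,j\le 2^{p-1}$, where $$A_{ii}=\begin{bmatrix}1&1\\1&1\end{bmatrix},\qquad A_{ij}=\begin{bmatrix}\gamma&1\\1&\bar\gamma\end{bmatrix}\ (i<j),\qquad A_{ij}=\begin{bmatrix}\bar\gamma&1\\1&\gamma\end{bmatrix}\ (i>j).$$ Let $\mathfrak L^p_\theta$ be the image of $\mathfrak L^p_0$ under entrywise (Schur) multiplication by $D(\theta)$. Put $\delta_p=\frac1{2^{p-1}}\sum_{k=1}^{2^{p-1}}\left|\cot\frac{(2k-1)\pi}{2^p}\right|$ and, for an integer $n\ge1$, let $\theta_n$ be the minimal positive solution of the equation $$2(1-\cos(\theta/2))+\delta_p\sin(\theta/2)=n^{-1}\ln(3/2).$$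 Corollary. Let $n\ge1$ be arbitrary, let $m\geq 1$ be a natural number such that $\theta_*=\pi/m\le\theta_n$, and let $\Phi_{\theta_*}$ be an arbitrary channel with input space $\mathbb C^{2^p}$ whose noncommutative graph is $\mathfrak L^p_{\theta_*}$. Then $$\bar Q_0(\Phi_{\theta_*}^{\otimes n})=0,\quad\text{but}\quad\bar Q_0(\Phi_{\theta_*}^{\otimes m})\ge p-1,\quad\text{and hence}\quad Q_0(\Phi_{\theta_*})\ge\frac{p-1}{m}.$$ Moreover, there exist $2^m$ mutually orthogonal $2^{p-1}$-dimensional error correcting codes for the channel $\Phi_{\theta_*}^{\otimes m}$. -/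

import Mathlib

/-! Finite-dimensional quantum systems are given by finite index types: the Hilbert space with
orthonormal basis indexed by `A` is `EuclideanSpace ℂ A`, its operators are `Matrix A A ℂ`. -/

noncomputable section

open scoped ComplexOrder

namespace QZE

/-! ### Channels -/

/-- The map `id_k ⊗ Φ`, which applies `Φ` to each block of a `k × k` block matrix. -/
def ampliation {A B : Type*} (k : ℕ) (Φ : Matrix A A ℂ →ₗ[ℂ] Matrix B B ℂ)
    (M : Matrix (Fin k × A) (Fin k × A) ℂ) : Matrix (Fin k × B) (Fin k × B) ℂ :=
  Matrix.of fun x y => Φ (Matrix.of fun a a' => M (x.1, a) (y.1, a')) x.2 y.2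

/-- Complete positivity: every `id_k ⊗ Φ` maps positive semidefinite matrices to positive
semidefinite ones. -/
def IsCompletelyPositive {A B : Type*} (Φ : Matrix A A ℂ →ₗ[ℂ] Matrix B B ℂ) : Prop :=
  ∀ (k : ℕ) (M : Matrix (Fin k × A) (Fin k × A) ℂ), M.PosSemidef → (ampliation k Φ M).PosSemidef

/-- A quantum channel: a completely positive trace-preserving linear map. -/
structure IsChannel {A B : Type*} [Fintype A] [Fintype B]
    (Φ : Matrix A A ℂ →ₗ[ℂ] Matrix B B ℂ) : Prop where
  completelyPositive : IsCompletelyPositive Φ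
  trace_preserving : ∀ ρ, (Φ ρ).trace = ρ.trace

/-- The dual map `Φ*`, determined by `Tr (Φ*(X) ρ) = Tr (X Φ(ρ))` (see `trace_dualMap_mul`). -/
def dualMap {A B : Type*} [Fintype B] [DecidableEq A]
    (Φ : Matrix A A ℂ →ₗ[ℂ] Matrix B B ℂ) : Matrix B B ℂ →ₗ[ℂ] Matrix A A ℂ where
  toFun X := Matrix.of fun i j => (X * Φ (Matrix.single j i 1)).trace
  map_add' X Y := by
    ext i j
    simp [add_mul, Matrix.trace_add]
  map_smul' c X := by
    ext i j
    simp [Matrix.trace_smul]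

theorem trace_dualMap_mul {A B : Type*} [Fintype A] [Fintype B] [DecidableEq A]
    (Φ : Matrix A A ℂ →ₗ[ℂ] Matrix B B ℂ) (X : Matrix B B ℂ) (ρ : Matrix A A ℂ) :
    (dualMap Φ X * ρ).trace = (X * Φ ρ).trace := by
  have h : Φ ρ = ∑ i, ∑ j, ρ i j • Φ (Matrix.single i j 1) := by
    conv_lhs => rw [Matrix.matrix_eq_sum_single ρ]
    simp only [map_sum]
    refine Finset.sum_congr rfl fun i _ => Finset.sum_congr rfl fun j _ => ?_
    rw [← map_smul, Matrix.smul_single, smul_eq_mul, mul_one]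
  rw [h]
  simp only [Finset.mul_sum, Matrix.trace_sum, Matrix.mul_smul, Matrix.trace_smul, smul_eq_mul]
  rw [Finset.sum_comm]
  simp only [Matrix.trace, Matrix.diag, Matrix.mul_apply, dualMap, LinearMap.coe_mk, AddHom.coe_mk,
    Matrix.of_apply]
  refine Finset.sum_congr rfl fun i _ => Finset.sum_congr rfl fun j _ => ?_
  ring

/-! ### Stinespring representations, complementary channels, noncommutative graphs -/

/-- Partial trace over the second factor. -/
def traceRight {B E : Type*} [Fintype E] (M : Matrix (B × E) (B × E) ℂ) : Matrix B B ℂ :=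
  Matrix.of fun b b' => ∑ e, M (b, e) (b', e)

/-- `V : H_A → H_B ⊗ H_E` is an isometry with `Φ(ρ) = Tr_E (V ρ V*)`. -/
def IsStinespring {A B E : Type*} [Fintype A] [Fintype B] [Fintype E] [DecidableEq A]
    (Φ : Matrix A A ℂ →ₗ[ℂ] Matrix B B ℂ) (V : Matrix (B × E) A ℂ) : Prop :=
  V.conjTranspose * V = 1 ∧ ∀ ρ, Φ ρ = traceRight (V * ρ * V.conjTranspose)

/-- The complementary channel `ρ ↦ Tr_B (V ρ V*)` given by the Stinespring isometry `V`. -/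
def complementary {A B E : Type*} [Fintype A] [Fintype B]
    (V : Matrix (B × E) A ℂ) : Matrix A A ℂ →ₗ[ℂ] Matrix E E ℂ where
  toFun ρ := Matrix.of fun e e' => ∑ b, (V * ρ * V.conjTranspose) (b, e) (b, e')
  map_add' ρ σ := by
    ext e e'
    simp [Matrix.mul_add, Matrix.add_mul, Finset.sum_add_distrib]
  map_smul' c ρ := by
    ext e e'
    simp [Finset.mul_sum]

/-- `L` is the noncommutative graph of `Φ`, that is, the range of the dual of a complementary
channel of `Φ` (the range is the same for all Stinespring isometries of `Φ`). -/
def HasNoncommutativeGraph {A B : Type*} [Fintype A] [Fintype B] [DecidableEq A]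
    (Φ : Matrix A A ℂ →ₗ[ℂ] Matrix B B ℂ) (L : Set (Matrix A A ℂ)) : Prop :=
  ∃ (d : ℕ) (V : Matrix (B × Fin d) A ℂ), IsStinespring Φ V ∧
    Set.range (dualMap (complementary V)) = L

/-! ### Tensor powers -/

/-- The tensor power `Φ^{⊗n}`, on matrices indexed by `Fin n → A` (the basis of `H_A^{⊗n}`). -/
def tensorPower {A B : Type*} [Fintype A] [DecidableEq A] (n : ℕ)
    (Φ : Matrix A A ℂ →ₗ[ℂ] Matrix B B ℂ) :
    Matrix (Fin n → A) (Fin n → A) ℂ →ₗ[ℂ] Matrix (Fin n → B) (Fin n → B) ℂ where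
  toFun ρ := Matrix.of fun b b' =>
    ∑ a, ∑ a', ρ a a' * ∏ i, Φ (Matrix.single (a i) (a' i) 1) (b i) (b' i)
  map_add' ρ σ := by
    ext b b'
    simp [add_mul, Finset.sum_add_distrib]
  map_smul' c ρ := by
    ext b b'
    simp [Finset.mul_sum, mul_assoc]

/-- The map `tensorPower n Φ` is the one that sends `M₁ ⊗ ⋯ ⊗ Mₙ` to `Φ(M₁) ⊗ ⋯ ⊗ Φ(Mₙ)`. -/
theorem tensorPower_prod {A B : Type*} [Fintype A] [DecidableEq A] (n : ℕ)
    (Φ : Matrix A A ℂ →ₗ[ℂ] Matrix B B ℂ) (M : Fin n → Matrix A A ℂ) :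
    tensorPower n Φ (Matrix.of fun a a' => ∏ i, M i (a i) (a' i)) =
      Matrix.of fun b b' => ∏ i, Φ (M i) (b i) (b' i) := by
  have h : ∀ ρ : Matrix A A ℂ, ∀ b b',
      Φ ρ b b' = ∑ x : A × A, ρ x.1 x.2 * Φ (Matrix.single x.1 x.2 1) b b' := by
    intro ρ b b'
    conv_lhs => rw [Matrix.matrix_eq_sum_single ρ]
    simp only [map_sum, Matrix.sum_apply, Fintype.sum_prod_type]
    refine Finset.sum_congr rfl fun i _ => Finset.sum_congr rfl fun j _ => ?_
    rw [← smul_eq_mul, ← Matrix.smul_apply, ← map_smul, Matrix.smul_single, smul_eq_mul, mul_one]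
  ext b b'
  have h2 : ∀ i, Φ (M i) (b i) (b' i) =
      ∑ x : A × A, M i x.1 x.2 * Φ (Matrix.single x.1 x.2 1) (b i) (b' i) := fun i => h _ _ _
  simp only [tensorPower, LinearMap.coe_mk, AddHom.coe_mk, Matrix.of_apply]
  rw [Finset.prod_congr rfl fun i _ => h2 i, Finset.prod_univ_sum, Fintype.piFinset_univ,
    ← Fintype.sum_prod_type']
  refine Fintype.sum_equiv (Equiv.arrowProdEquivProdArrow (Fin n) (fun _ => A) (fun _ => A)).symm
    _ _ fun x => ?_
  rw [← Finset.prod_mul_distrib]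
  rfl

/-! ### Error correcting codes and zero-error capacities -/

/-- A state supported by the subspace `H`. -/
def IsStateOn {A : Type*} [Fintype A] [DecidableEq A] (H : Submodule ℂ (EuclideanSpace ℂ A))
    (ρ : Matrix A A ℂ) : Prop :=
  ρ.PosSemidef ∧ ρ.trace = 1 ∧ LinearMap.range (Matrix.toEuclideanLin ρ) ≤ H

/-- `H` is an error correcting code for `Φ`: some channel `Θ` recovers all states on `H`. -/
def IsErrorCorrectingCode {A B : Type*} [Fintype A] [Fintype B] [DecidableEq A]
    (Φ : Matrix A A ℂ →ₗ[ℂ] Matrix B B ℂ) (H : Submodule ℂ (EuclideanSpace ℂ A)) : Prop :=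
  ∃ Θ : Matrix B B ℂ →ₗ[ℂ] Matrix A A ℂ, IsChannel Θ ∧ ∀ ρ, IsStateOn H ρ → Θ (Φ ρ) = ρ

/-- The set of all `log₂ (dim H)`, where `H` is a (nonzero) error correcting code for `Φ`. -/
def codeRates {A B : Type*} [Fintype A] [Fintype B] [DecidableEq A]
    (Φ : Matrix A A ℂ →ₗ[ℂ] Matrix B B ℂ) : Set ℝ :=
  {r | ∃ H : Submodule ℂ (EuclideanSpace ℂ A), H ≠ ⊥ ∧ IsErrorCorrectingCode Φ H ∧
    r = Real.logb 2 (Module.finrank ℂ H)}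

/-- The 1-shot quantum zero-error capacity (a supremum of a bounded set). -/
def oneShotCapacity {A B : Type*} [Fintype A] [Fintype B] [DecidableEq A]
    (Φ : Matrix A A ℂ →ₗ[ℂ] Matrix B B ℂ) : ℝ :=
  sSup (codeRates Φ)

/-- The set of all `n⁻¹ Q̄₀(Φ^{⊗n})`, `n ≥ 1`. -/
def nShotRates {A B : Type*} [Fintype A] [Fintype B] [DecidableEq A]
    (Φ : Matrix A A ℂ →ₗ[ℂ] Matrix B B ℂ) : Set ℝ :=
  {r | ∃ n : ℕ, 1 ≤ n ∧ r = (n : ℝ)⁻¹ * oneShotCapacity (tensorPower n Φ)}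

/-- The (asymptotic) quantum zero-error capacity (a supremum of a bounded set). -/
def zeroErrorCapacity {A B : Type*} [Fintype A] [Fintype B] [DecidableEq A]
    (Φ : Matrix A A ℂ →ₗ[ℂ] Matrix B B ℂ) : ℝ :=
  sSup (nShotRates Φ)

theorem le_of_mem_codeRates {A B : Type*} [Fintype A] [Fintype B] [DecidableEq A]
    (Φ : Matrix A A ℂ →ₗ[ℂ] Matrix B B ℂ) {r : ℝ} (hr : r ∈ codeRates Φ) :
    r ≤ Real.logb 2 (Fintype.card A) := by
  obtain ⟨H, hH, -, rfl⟩ := hr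
  have h1 : 0 < Module.finrank ℂ H := by
    have := Submodule.one_le_finrank_iff.2 hH
    omega
  have h2 : Module.finrank ℂ H ≤ Fintype.card A := by
    simpa using Submodule.finrank_le H
  exact Real.logb_le_logb_of_le (by norm_num) (by exact_mod_cast h1) (by exact_mod_cast h2)

theorem bddAbove_codeRates {A B : Type*} [Fintype A] [Fintype B] [DecidableEq A]
    (Φ : Matrix A A ℂ →ₗ[ℂ] Matrix B B ℂ) : BddAbove (codeRates Φ) :=
  ⟨_, fun _ hr => le_of_mem_codeRates Φ hr⟩

theorem bddAbove_nShotRates {A B : Type*} [Fintype A] [Fintype B] [DecidableEq A]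
    (Φ : Matrix A A ℂ →ₗ[ℂ] Matrix B B ℂ) : BddAbove (nShotRates Φ) := by
  refine ⟨Real.logb 2 (Fintype.card A), ?_⟩
  rintro r ⟨n, hn, rfl⟩
  have hn0 : (0 : ℝ) < n := by exact_mod_cast hn
  have hlog : 0 ≤ Real.logb 2 (Fintype.card A : ℝ) := by
    rcases Nat.eq_zero_or_pos (Fintype.card A) with h | h
    · simp [h]
    · exact Real.logb_nonneg (by norm_num) (by exact_mod_cast h)
  have hle : oneShotCapacity (tensorPower n Φ) ≤ n * Real.logb 2 (Fintype.card A) := by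
    refine Real.sSup_le (fun r hr => ?_) (by positivity)
    have := le_of_mem_codeRates _ hr
    rwa [Fintype.card_fun, Fintype.card_fin, Nat.cast_pow, Real.logb_pow] at this
  rw [inv_mul_le_iff₀ hn0]
  exact hle

/-! ### The subspaces `𝔏^p_θ` -/

/-- The bijection that splits a `2^(p+1) × 2^(p+1)` matrix into four `2^p × 2^p` blocks. -/
def blockEquiv (p : ℕ) : Fin (2 ^ p) ⊕ Fin (2 ^ p) ≃ Fin (2 ^ (p + 1)) :=
  finSumFinEquiv.trans (finCongr (by ring))

/-- The algebra `𝔏^p_0 = 𝔄₂^{⊗p}`: all the matrices `[[A, B], [B, A]]` with `A, B ∈ 𝔏^{p-1}_0`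
(where `𝔏^0_0` is the algebra of all `1 × 1` matrices, so that `𝔏^1_0 = 𝔄₂`). -/
def undeformed : (p : ℕ) → Set (Matrix (Fin (2 ^ p)) (Fin (2 ^ p)) ℂ)
  | 0 => Set.univ
  | p + 1 => {M | ∃ A ∈ undeformed p, ∃ B ∈ undeformed p,
      M = Matrix.reindex (blockEquiv p) (blockEquiv p) (Matrix.fromBlocks A B B A)}

/-- The `2 × 2` block of `D(θ)` in block position `(i, j)`, where `γ = exp(iθ/2)`. -/
def deformationBlock (γ : ℂ) (i j : ℕ) : Matrix (Fin 2) (Fin 2) ℂ :=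
  if i < j then !![γ, 1; 1, star γ]
  else if j < i then !![star γ, 1; 1, γ]
  else !![1, 1; 1, 1]

/-- The `2^p × 2^p` matrix `D(θ)`, made of `2 × 2` blocks. -/
def deformation (p : ℕ) (θ : ℝ) : Matrix (Fin (2 ^ p)) (Fin (2 ^ p)) ℂ :=
  Matrix.of fun j k =>
    deformationBlock (Complex.exp (Complex.I / 2 * θ)) (j.val / 2) (k.val / 2)
      (Fin.ofNat 2 j.val) (Fin.ofNat 2 k.val)

/-- The subspace `𝔏^p_θ`: the image of `𝔏^p_0` under Schur multiplication by `D(θ)`. -/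
def deformed (p : ℕ) (θ : ℝ) : Set (Matrix (Fin (2 ^ p)) (Fin (2 ^ p)) ℂ) :=
  (fun M => Matrix.hadamard (deformation p θ) M) '' undeformed p

/-! ### The angle `θ_n` -/

/-- The constant `δ_p`. -/
def delta (p : ℕ) : ℝ :=
  1 / 2 ^ (p - 1) * 
    ∑ k ∈ Finset.Icc (1 : ℕ) (2 ^ (p - 1)), |Real.cot ((2 * (k : ℝ) - 1) * Real.pi / 2 ^ p)|

/-- The positive solutions of `2 (1 - cos (θ/2)) + δ_p sin (θ/2) = n⁻¹ ln (3/2)`. -/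
def thetaSolutions (p n : ℕ) : Set ℝ :=
  {θ | 0 < θ ∧ 2 * (1 - Real.cos (θ / 2)) + delta p * Real.sin (θ / 2)
    = (n : ℝ)⁻¹ * Real.log (3 / 2)}

/-- The minimal positive solution `θ_n` (see `isLeast_theta`). -/
def theta (p n : ℕ) : ℝ := sInf (thetaSolutions p n)

theorem delta_nonneg (p : ℕ) : 0 ≤ delta p :=
  mul_nonneg (by positivity) (Finset.sum_nonneg fun _ _ => abs_nonneg _)

theorem isLeast_theta (p n : ℕ) (hn : 1 ≤ n) : IsLeast (thetaSolutions p n) (theta p n) := by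
  set c : ℝ := (n : ℝ)⁻¹ * Real.log (3 / 2) with hc
  set f : ℝ → ℝ := fun θ => 2 * (1 - Real.cos (θ / 2)) + delta p * Real.sin (θ / 2) with hf
  have hn0 : (1 : ℝ) ≤ n := by exact_mod_cast hn
  have hcont : Continuous f := by fun_prop
  have hlog : 0 < Real.log (3 / 2) := Real.log_pos (by norm_num)
  have hc0 : 0 < c := by positivity
  have hc1 : c ≤ 2 := by
    have h1 : Real.log (3 / 2) ≤ 3 / 2 - 1 := Real.log_le_sub_one_of_pos (by norm_num)
    have h2 : (n : ℝ)⁻¹ ≤ 1 := inv_le_one_of_one_le₀ hn0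
    have h3 : c ≤ 1 * Real.log (3 / 2) := mul_le_mul_of_nonneg_right h2 hlog.le
    linarith
  have hf0 : f 0 = 0 := by simp [hf]
  have hset : thetaSolutions p n = Set.Ici 0 ∩ f ⁻¹' {c} := by
    ext θ
    constructor
    · rintro ⟨h1, h2⟩
      exact ⟨h1.le, h2⟩
    · rintro ⟨h1, h2⟩
      refine ⟨lt_of_le_of_ne h1 ?_, h2⟩
      rintro rfl
      have h3 : f 0 = c := h2
      linarith
  have hclosed : IsClosed (thetaSolutions p n) := by
    rw [hset]
    exact isClosed_Ici.inter (isClosed_singleton.preimage hcont)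
  have hne : (thetaSolutions p n).Nonempty := by
    have hpi : c ≤ f Real.pi := by
      have := delta_nonneg p
      simp only [hf, Real.cos_pi_div_two, Real.sin_pi_div_two]
      linarith
    obtain ⟨θ, h1, h2⟩ := intermediate_value_Icc Real.pi_pos.le hcont.continuousOn
      (show c ∈ Set.Icc (f 0) (f Real.pi) from ⟨by rw [hf0]; exact hc0.le, hpi⟩)
    exact ⟨θ, hset ▸ ⟨h1.1, h2⟩⟩
  have hbdd : BddBelow (thetaSolutions p n) := ⟨0, fun θ hθ => hθ.1.le⟩
  exact ⟨hclosed.csInf_mem hne hbdd, fun θ hθ => csInf_le hbdd hθ⟩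

end QZE

end

/-! The Knill–Laflamme criterion turns error correction into linear algebra: a subspace with
orthonormal basis `φ₁, …, φ_d` is an error correcting code for `Φ` if and only if
`⟨φ_k, M φ_l⟩ = c(M) δ_kl` for all `M` in the noncommutative graph of `Φ`. The graph is spanned by the products
`(K e)* (K f)` of Kraus operators, so that the graph of `Φ^{⊗n}` is spanned by the tensor products
of elements of the graph of `Φ`.

*The capacity of `Φ^{⊗n}` vanishes.* For `θ = 0` the graph is a maximal commutative `*`-algebra:
it contains the projections onto the vectors `h k` of an orthonormal basis. For two orthogonal
unit vectors of a code with coefficients `a k`, `b k` in this basis, the criterion would give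
`a k * b k = 0` and `|a k| = |b k|` for all `k`, which is absurd. This contradiction is stable: it
persists if the algebra is deformed by a Schur multiplier whose distance to the all-ones matrix is
less than `1/2` (`not_knillLaflamme_of_schurBound`). The distance is measured by `SchurBound`,
which bounds the sum of the absolute values of the coefficients in a decomposition into rank one
matrices with entries in the unit disc; this quantity is submultiplicative for tensor products, so
that the distance for `D(θ)^{⊗n}` is at most `(1 + x)ⁿ - 1`, where `x` is the distance for `D(θ)`.
Diagonalizing the matrix of signs, which is skew-circulant with eigenvalues `i cot ((2k-1)π/2^p)`,
gives `x ≤ 2 (1 - cos (θ/2)) + δ_p sin (θ/2)` (`schurBound_deformation`). For `θ ≤ θ_n` this is at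
most `ln (3/2) / n`, and `(1 + ln (3/2) / n)ⁿ < 3/2`.

*The codes of `Φ^{⊗m}`.* For `θ = π/m` the vectors `(|2k, …, 2k⟩ + i |2k+1, …, 2k+1⟩) / √2`
satisfy the Knill–Laflamme conditions: the terms with mixed parity cancel because of the factor
`i`, and for `k ≠ l` the two other terms have the opposite phases `γ^m = i` and `conj γ^m = -i`
(`exists_codeMatrix_compression_eq_smul`). The entries of the matrices in `𝔏^p_θ` do not change
when both indices are reversed, `j ↦ 2^p - 1 - j`. Reversal in any subset of the `m` tensor
factors therefore gives another code, and the `2^m` codes obtained in this way are mutually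
orthogonal. -/

noncomputable section

open scoped ComplexOrder

namespace QZE

open Matrix

/-! ### Kraus operators -/

/-- `K` is a family of Kraus operators for `Φ`, that is, `Φ(ρ) = ∑ e, K e ρ (K e)*`. -/
def HasKraus {A B ι : Type*} [Fintype A] [Fintype ι]
    (Φ : Matrix A A ℂ →ₗ[ℂ] Matrix B B ℂ) (K : ι → Matrix B A ℂ) : Prop :=
  ∀ ρ, Φ ρ = ∑ e, K e * ρ * (K e)ᴴ

theorem mul_single_mul_apply {A B : Type*} [Fintype A] [DecidableEq A]
    (K : Matrix B A ℂ) (i j : A) (b b' : B) :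
    (K * single i j (1 : ℂ) * Kᴴ) b b' = K b i * star (K b' j) := by
  rw [Matrix.mul_assoc, mul_apply, Finset.sum_eq_single i]
  · simp
  · intro x _ hx
    simp [hx]
  · simp

theorem apply_eq_sum_single {A B : Type*} [Fintype A] [DecidableEq A]
    (Φ : Matrix A A ℂ →ₗ[ℂ] Matrix B B ℂ) (ρ : Matrix A A ℂ) :
    Φ ρ = ∑ i, ∑ j, ρ i j • Φ (single i j 1) := by
  conv_lhs => rw [matrix_eq_sum_single ρ]
  simp only [map_sum]
  refine Finset.sum_congr rfl fun i _ => Finset.sum_congr rfl fun j _ => ?_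
  rw [← map_smul, smul_single, smul_eq_mul, mul_one]

theorem HasKraus.apply_single {A B ι : Type*} [Fintype A] [Fintype ι] [DecidableEq A]
    {Φ : Matrix A A ℂ →ₗ[ℂ] Matrix B B ℂ} {K : ι → Matrix B A ℂ}
    (h : HasKraus Φ K) (i j : A) (b b' : B) :
    Φ (single i j 1) b b' = ∑ e, K e b i * star (K e b' j) := by
  rw [h, Matrix.sum_apply]
  simp_rw [mul_single_mul_apply]

/-- It suffices to check a Kraus representation on matrix units. -/
theorem hasKraus_of_single {A B ι : Type*} [Fintype A] [Fintype ι] [DecidableEq A]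
    {Φ : Matrix A A ℂ →ₗ[ℂ] Matrix B B ℂ} {K : ι → Matrix B A ℂ}
    (h : ∀ i j b b', Φ (single i j 1) b b' = ∑ e, K e b i * star (K e b' j)) :
    HasKraus Φ K := by
  intro ρ
  ext b b'
  rw [apply_eq_sum_single]
  simp only [Matrix.sum_apply, Matrix.smul_apply, h, smul_eq_mul, mul_apply, Finset.mul_sum,
    Finset.sum_mul, conjTranspose_apply]
  rw [Finset.sum_comm_cycle]
  refine Finset.sum_congr rfl fun e _ => ?_
  rw [Finset.sum_comm]
  refine Finset.sum_congr rfl fun j _ => Finset.sum_congr rfl fun i _ => ?_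
  ring

/-- **Choi's theorem**: a completely positive map has a Kraus representation. The Kraus operators
come from a factorization of the Choi matrix, the image under `id ⊗ Φ` of the (unnormalized)
maximally entangled state. -/
theorem IsCompletelyPositive.exists_hasKraus {A B : Type*} [Fintype A] [Fintype B] [DecidableEq A]
    {Φ : Matrix A A ℂ →ₗ[ℂ] Matrix B B ℂ} (h : IsCompletelyPositive Φ) :
    ∃ (k : ℕ) (K : Fin k → Matrix B A ℂ), HasKraus Φ K := by
  classical
  let e := (Fintype.equivFin A).symm
  let v : Fin (Fintype.card A) × A → ℂ := fun x => if e x.1 = x.2 then 1 else 0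
  have hC := h _ _ (posSemidef_vecMulVec_self_star v)
  obtain ⟨k, w, hw⟩ := posSemidef_iff_eq_sum_vecMulVec.mp hC
  refine ⟨k, fun j => Matrix.of fun b a => w j (e.symm a, b), hasKraus_of_single ?_⟩
  intro i j b b'
  have h1 := congrFun (congrFun hw (e.symm i, b)) (e.symm j, b')
  have h2 : (Matrix.of fun a a' => vecMulVec v (star v) (e.symm i, a) (e.symm j, a'))
      = single i j (1 : ℂ) := by
    ext a a'
    by_cases h3 : i = a <;> simp [vecMulVec_apply, v, single_apply, h3]
  rw [ampliation, of_apply, h2] at h1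
  rw [h1, Matrix.sum_apply]
  rfl

/-- A map with a Kraus representation is completely positive. -/
theorem HasKraus.isCompletelyPositive {A B ι : Type*} [Fintype A] [Finite B] [Fintype ι]
    {Φ : Matrix A A ℂ →ₗ[ℂ] Matrix B B ℂ} {K : ι → Matrix B A ℂ}
    (h : HasKraus Φ K) : IsCompletelyPositive Φ := by
  classical
  intro k M hM
  let L : ι → Matrix (Fin k × B) (Fin k × A) ℂ := fun e =>
    Matrix.of fun x y => if x.1 = y.1 then K e x.2 y.2 else 0
  have hL : ampliation k Φ M = ∑ e, L e * M * (L e)ᴴ := by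
    ext x y
    simp only [ampliation, h _, Matrix.sum_apply, of_apply, mul_apply, conjTranspose_apply, L,
      Fintype.sum_prod_type]
    refine Finset.sum_congr rfl fun e _ => ?_
    rw [Finset.sum_eq_single y.1]
    · refine Finset.sum_congr rfl fun a' _ => ?_
      rw [Finset.sum_eq_single x.1]
      · simp
      · intro z _ hz
        simp [hz.symm]
      · simp
    · intro z _ hz
      simp [hz.symm]
    · simp
  rw [hL]
  exact posSemidef_sum _ fun e _ => hM.mul_mul_conjTranspose_same _

theorem HasKraus.sum_conjTranspose_mul_self {A B ι : Type*} [Fintype A] [Fintype B] [Fintype ι]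
    [DecidableEq A] {Φ : Matrix A A ℂ →ₗ[ℂ] Matrix B B ℂ} {K : ι → Matrix B A ℂ}
    (h : HasKraus Φ K) (hΦ : ∀ ρ, (Φ ρ).trace = ρ.trace) : ∑ e, (K e)ᴴ * K e = 1 := by
  ext i j
  have h1 := hΦ (single j i 1)
  simp only [trace, diag, h.apply_single] at h1
  rw [Matrix.sum_apply]
  simp only [mul_apply, conjTranspose_apply]
  rw [Finset.sum_comm]
  simp only [mul_comm (star _)]
  rw [h1]
  simp [single_apply, one_apply, ite_and]

theorem HasKraus.isChannel {A B ι : Type*} [Fintype A] [Fintype B] [Fintype ι]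
    [DecidableEq A] {Φ : Matrix A A ℂ →ₗ[ℂ] Matrix B B ℂ} {K : ι → Matrix B A ℂ}
    (h : HasKraus Φ K) (hK : ∑ e, (K e)ᴴ * K e = 1) : IsChannel Φ where
  completelyPositive := h.isCompletelyPositive
  trace_preserving ρ := by
    simp only [h ρ, trace_sum]
    simp_rw [Matrix.mul_assoc, trace_mul_comm (K _), Matrix.mul_assoc]
    rw [← trace_sum, ← Matrix.mul_sum, hK, Matrix.mul_one]

/-- The Kraus operators may be mixed by a unitary matrix. -/
theorem HasKraus.unitary_mix {A B ι : Type*} [Fintype A] [Fintype ι] [DecidableEq ι]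
    {Φ : Matrix A A ℂ →ₗ[ℂ] Matrix B B ℂ} {K : ι → Matrix B A ℂ}
    (h : HasKraus Φ K) {U : Matrix ι ι ℂ} (hU : U * Uᴴ = 1) :
    HasKraus Φ fun i => ∑ e, U e i • K e := by
  intro ρ
  have h1 : ∀ i, (∑ e, U e i • K e) * ρ * (∑ e, U e i • K e)ᴴ =
      ∑ e, ∑ f, (U e i * star (U f i)) • (K e * ρ * (K f)ᴴ) := by
    intro i
    simp only [conjTranspose_sum, conjTranspose_smul, Matrix.sum_mul, Matrix.mul_sum,
      Matrix.smul_mul, Matrix.mul_smul, Finset.smul_sum, smul_smul]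
    rw [Finset.sum_comm]
    simp only [mul_comm]
  simp only [h1]
  rw [Finset.sum_comm, h ρ]
  refine Finset.sum_congr rfl fun e _ => ?_
  rw [Finset.sum_comm]
  simp only [← Finset.sum_smul]
  have h2 : ∀ f, ∑ i, U e i * star (U f i) = (1 : Matrix ι ι ℂ) e f := fun f => by
    rw [← hU, mul_apply]; rfl
  simp only [h2, one_apply, ite_smul, one_smul, zero_smul, Finset.sum_ite_eq, Finset.mem_univ,
    if_true]

/-! ### The Knill–Laflamme conditions -/

/-- A linear map that fixes all the states on `H` fixes the unnormalized pure states too. -/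
theorem map_vecMulVec_eq_of_isStateOn {A : Type*} [Fintype A] [DecidableEq A]
    {Ψ : Matrix A A ℂ →ₗ[ℂ] Matrix A A ℂ} {H : Submodule ℂ (EuclideanSpace ℂ A)}
    (h : ∀ ρ, IsStateOn H ρ → Ψ ρ = ρ) {φ : A → ℂ} (hφ : WithLp.toLp 2 φ ∈ H) :
    Ψ (vecMulVec φ (star φ)) = vecMulVec φ (star φ) := by
  rcases eq_or_ne φ 0 with rfl | h0
  · simp
  set s : ℂ := φ ⬝ᵥ star φ with hs
  have hs0 : s ≠ 0 := fun h1 => h0 (dotProduct_self_star_eq_zero.1 h1)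
  have hpos : 0 ≤ s := dotProduct_self_star_nonneg φ
  have hst : IsStateOn H (s⁻¹ • vecMulVec φ (star φ)) := by
    refine ⟨(posSemidef_vecMulVec_self_star φ).smul (inv_nonneg.2 hpos), ?_, ?_⟩
    · rw [trace_smul, trace_vecMulVec, smul_eq_mul, inv_mul_cancel₀ hs0]
    · rintro _ ⟨x, rfl⟩
      have : toEuclideanLin (s⁻¹ • vecMulVec φ (star φ)) x =
          (s⁻¹ * (star φ ⬝ᵥ x.ofLp)) • WithLp.toLp 2 φ := by
        ext i
        simp [toLpLin_apply, vecMulVec_mulVec]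
        ring
      rw [this]
      exact H.smul_mem _ hφ
  have h1 := h _ hst
  rw [map_smul] at h1
  exact smul_right_injective _ (inv_ne_zero hs0) h1

/-- If `φφ*` is a fixed point of a map with Kraus operators `T t`, then `φ` is a common eigenvector
of the `T t`. -/
theorem exists_mulVec_eq_smul {A ι : Type*} [Fintype A] [Fintype ι] {T : ι → Matrix A A ℂ}
    {φ : A → ℂ} (h : ∑ t, T t * vecMulVec φ (star φ) * (T t)ᴴ = vecMulVec φ (star φ)) (t : ι) :
    ∃ c : ℂ, T t *ᵥ φ = c • φ := by
  rcases eq_or_ne φ 0 with rfl | h0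
  · exact ⟨0, by simp⟩
  have hs0 : star φ ⬝ᵥ φ ≠ 0 := fun h1 => h0 (dotProduct_star_self_eq_zero.1 h1)
  -- every vector orthogonal to `φ` is orthogonal to `T t φ`
  have key : ∀ χ : A → ℂ, star χ ⬝ᵥ φ = 0 → star χ ⬝ᵥ T t *ᵥ φ = 0 := by
    intro χ hχ
    have h1 := congrArg (fun M => star χ ⬝ᵥ M *ᵥ χ) h
    simp only [Matrix.sum_mulVec, dotProduct_sum] at h1
    have h2 : ∀ u : A → ℂ, star χ ⬝ᵥ vecMulVec u (star u) *ᵥ χ = 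
        (star χ ⬝ᵥ u) * star (star χ ⬝ᵥ u) := by
      intro u
      rw [vecMulVec_mulVec, dotProduct_smul, ← star_dotProduct]
      simp
    have h3 : ∀ t, T t * vecMulVec φ (star φ) * (T t)ᴴ =
        vecMulVec (T t *ᵥ φ) (star (T t *ᵥ φ)) := by
      intro t
      rw [mul_vecMulVec, vecMulVec_mul, star_mulVec]
    simp only [h2, h3, hχ, zero_mul] at h1
    have h4 := (Finset.sum_eq_zero_iff_of_nonneg fun i _ => mul_star_self_nonneg _).1 h1 t
      (Finset.mem_univ _)
    simpa using h4
  refine ⟨(star φ ⬝ᵥ T t *ᵥ φ) / (star φ ⬝ᵥ φ), ?_⟩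
  set c := (star φ ⬝ᵥ T t *ᵥ φ) / (star φ ⬝ᵥ φ) with hc
  set χ := T t *ᵥ φ - c • φ with hχ
  have h1 : star φ ⬝ᵥ χ = 0 := by
    rw [hχ, dotProduct_sub, dotProduct_smul, smul_eq_mul, hc, div_mul_cancel₀ _ hs0, sub_self]
  have h2 : star χ ⬝ᵥ φ = 0 := by
    rw [star_dotProduct, h1, star_zero]
  have h3 : star χ ⬝ᵥ χ = 0 := by
    conv_lhs => rw [hχ, dotProduct_sub, dotProduct_smul]
    rw [key χ h2, h2, smul_zero, sub_zero]
  have h4 : χ = 0 := dotProduct_star_self_eq_zero.1 h3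
  exact sub_eq_zero.1 h4

/-- Necessity of the Knill–Laflamme conditions, for a pair of orthogonal unit vectors of a code. -/
theorem IsErrorCorrectingCode.knillLaflamme {A B ι : Type*} [Fintype A] [Fintype B] [Fintype ι]
    [DecidableEq A] {Φ : Matrix A A ℂ →ₗ[ℂ] Matrix B B ℂ} {K : ι → Matrix B A ℂ}
    (hK : HasKraus Φ K) {H : Submodule ℂ (EuclideanSpace ℂ A)} (hH : IsErrorCorrectingCode Φ H)
    {φ ψ : A → ℂ} (hφH : WithLp.toLp 2 φ ∈ H) (hψH : WithLp.toLp 2 ψ ∈ H)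
    (hφ : star φ ⬝ᵥ φ = 1) (hψ : star ψ ⬝ᵥ ψ = 1) (hφψ : star φ ⬝ᵥ ψ = 0) (e f : ι) :
    star φ ⬝ᵥ ((K e)ᴴ * K f) *ᵥ ψ = 0 ∧
      star φ ⬝ᵥ ((K e)ᴴ * K f) *ᵥ φ = star ψ ⬝ᵥ ((K e)ᴴ * K f) *ᵥ ψ := by
  classical
  obtain ⟨Θ, hΘ, hrec⟩ := hH
  obtain ⟨k, R, hR⟩ := hΘ.completelyPositive.exists_hasKraus
  have hR1 := hR.sum_conjTranspose_mul_self hΘ.trace_preserving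
  have hT : HasKraus (Θ ∘ₗ Φ) fun t : Fin k × ι => R t.1 * K t.2 := by
    intro ρ
    simp only [LinearMap.comp_apply, hK ρ, hR _, Fintype.sum_prod_type, conjTranspose_mul,
      Matrix.mul_sum, Matrix.sum_mul, Matrix.mul_assoc]
  have heig : ∀ χ : A → ℂ, WithLp.toLp 2 χ ∈ H → ∀ t : Fin k × ι,
      ∃ c : ℂ, (R t.1 * K t.2) *ᵥ χ = c • χ := fun χ hχ t => by
    have := map_vecMulVec_eq_of_isStateOn (Ψ := Θ ∘ₗ Φ) hrec hχ
    rw [hT] at this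
    exact exists_mulVec_eq_smul this t
  have hψφ : star ψ ⬝ᵥ φ = 0 := by rw [star_dotProduct, hφψ, star_zero]
  -- the eigenvalues at `φ` and `ψ` agree, because `φ + ψ` is an eigenvector too
  have hc : ∀ t : Fin k × ι, ∃ c : ℂ, (R t.1 * K t.2) *ᵥ φ = c • φ ∧
      (R t.1 * K t.2) *ᵥ ψ = c • ψ := by
    intro t
    obtain ⟨a, ha⟩ := heig φ hφH t
    obtain ⟨b, hb⟩ := heig ψ hψH t
    obtain ⟨c, hc⟩ := heig (φ + ψ) (H.add_mem hφH hψH) t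
    rw [mulVec_add, ha, hb] at hc
    have h1 := congrArg (star φ ⬝ᵥ ·) hc
    have h2 := congrArg (star ψ ⬝ᵥ ·) hc
    simp only [dotProduct_add, dotProduct_smul, hφ, hψ, hφψ, hψφ, smul_add, smul_eq_mul,
      mul_one, mul_zero, add_zero, zero_add] at h1 h2
    exact ⟨c, by rw [ha, h1], by rw [hb, h2]⟩
  choose c hc1 hc2 using hc
  have hexp : ∀ χ ω : A → ℂ, star χ ⬝ᵥ ((K e)ᴴ * K f) *ᵥ ω =
      ∑ j, star ((R j * K e) *ᵥ χ) ⬝ᵥ ((R j * K f) *ᵥ ω) := by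
    intro χ ω
    have : (K e)ᴴ * K f = ∑ j, (R j * K e)ᴴ * (R j * K f) := by
      have h1 : ∀ j, (R j * K e)ᴴ * (R j * K f) = (K e)ᴴ * ((R j)ᴴ * R j) * K f := fun j => by
        simp only [conjTranspose_mul, Matrix.mul_assoc]
      simp only [h1]
      rw [← Matrix.sum_mul, ← Matrix.mul_sum, hR1, Matrix.mul_one]
    rw [this, Matrix.sum_mulVec, dotProduct_sum]
    refine Finset.sum_congr rfl fun j _ => ?_
    rw [← mulVec_mulVec, dotProduct_mulVec, star_mulVec]
  constructor
  · rw [hexp]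
    refine Finset.sum_eq_zero fun j _ => ?_
    rw [hc1 (j, e), hc2 (j, f), star_smul, smul_dotProduct, dotProduct_smul, hφψ, smul_zero,
      smul_zero]
  · rw [hexp, hexp]
    refine Finset.sum_congr rfl fun j _ => ?_
    rw [hc1 (j, e), hc2 (j, f), hc1 (j, f), hc2 (j, e), star_smul, star_smul, smul_dotProduct,
      dotProduct_smul, smul_dotProduct, dotProduct_smul, hφ, hψ]

/-- Sufficiency of the Knill–Laflamme conditions, for Kraus operators that are orthogonal on the
code. The recovery channel has the Kraus operators `μᵢ^{-1/2} P P* (K i)*`, completed by a channel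
that prepares a fixed state on the orthogonal complement of their initial spaces. -/
theorem exists_recovery_of_diagonal {A B ι κ : Type*} [Fintype A] [Fintype B] [Fintype ι]
    [Fintype κ] [DecidableEq A] [DecidableEq ι] [DecidableEq κ] [Nonempty A]
    {K : ι → Matrix B A ℂ} {P : Matrix A κ ℂ} (hP : Pᴴ * P = 1) {μ : ι → ℝ} (hμ : ∀ i, 0 ≤ μ i)
    (hμ1 : ∑ i, μ i = 1)
    (h : ∀ i j, (K i * P)ᴴ * (K j * P) = if i = j then (μ i : ℂ) • 1 else 0) :
    ∃ Θ : Matrix B B ℂ →ₗ[ℂ] Matrix A A ℂ, IsChannel Θ ∧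
      ∀ σ : Matrix κ κ ℂ, Θ (∑ i, K i * (P * σ * Pᴴ) * (K i)ᴴ) = P * σ * Pᴴ := by
  classical
  let s : ι → ℝ := fun i => (Real.sqrt (μ i))⁻¹
  let W : ι → Matrix B κ ℂ := fun i => K i * P
  have hW : ∀ i j, (W i)ᴴ * W j = if i = j then (μ i : ℂ) • 1 else 0 := h
  -- `s i` is `0` when `μ i = 0`; the next identity holds in that case too, because `W i = 0`
  have hsW : ∀ i, ((s i : ℂ) * s i * μ i) • W i = W i := by
    intro i
    rcases eq_or_ne (μ i) 0 with h0 | h0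
    · have : W i = 0 := by
        rw [← conjTranspose_mul_self_eq_zero, hW, if_pos rfl, h0]
        simp
      rw [this, smul_zero]
    · have h1 : s i * s i * μ i = 1 := by
        have h3 : 0 < μ i := lt_of_le_of_ne (hμ i) h0.symm
        simp only [s]
        rw [← mul_inv, Real.mul_self_sqrt (hμ i), inv_mul_cancel₀ h0]
      have h2 : (s i : ℂ) * s i * μ i = 1 := by exact_mod_cast h1
      rw [h2, one_smul]
  let N : Matrix B B ℂ := ∑ i, ((s i : ℂ) * s i) • (W i * (W i)ᴴ)
  have hNW : ∀ j, N * W j = W j := by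
    intro j
    simp only [N, Matrix.sum_mul, Matrix.smul_mul, Matrix.mul_assoc, hW]
    rw [Finset.sum_eq_single j]
    · rw [if_pos rfl, Matrix.mul_smul, Matrix.mul_one, smul_smul, hsW]
    · intro i _ hij
      simp [hij]
    · simp
  have hNN : N * N = N := by
    conv_lhs => rhs; simp only [N]
    rw [Matrix.mul_sum]
    simp only [Matrix.mul_smul, ← Matrix.mul_assoc, hNW]
    rfl
  have hNH : Nᴴ = N := by
    simp only [N, conjTranspose_sum, conjTranspose_smul, conjTranspose_mul,
      conjTranspose_conjTranspose]
    simp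
  let Q : Matrix B B ℂ := 1 - N
  have hQW : ∀ j, Q * W j = 0 := fun j => by
    simp only [Q, Matrix.sub_mul, hNW, Matrix.one_mul, sub_self]
  have hQQ : Qᴴ * Q = Q := by
    simp only [Q, conjTranspose_sub, hNH, conjTranspose_one, Matrix.sub_mul, Matrix.mul_sub, hNN,
      Matrix.one_mul, Matrix.mul_one, sub_self, sub_zero]
  obtain ⟨a₀⟩ := ‹Nonempty A›
  let R : ι ⊕ B → Matrix A B ℂ := Sum.elim (fun i => (s i : ℂ) • (P * (W i)ᴴ))
    (fun b => single a₀ b (1 : ℂ) * Q)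
  let Θ : Matrix B B ℂ →ₗ[ℂ] Matrix A A ℂ :=
    { toFun := fun X => ∑ r, R r * X * (R r)ᴴ
      map_add' := fun X Y => by simp only [Matrix.mul_add, Matrix.add_mul, Finset.sum_add_distrib]
      map_smul' := fun c X => by
        simp only [Matrix.mul_smul, Matrix.smul_mul, Finset.smul_sum, RingHom.id_apply] }
  have hΘ : HasKraus Θ R := fun ρ => rfl
  refine ⟨Θ, hΘ.isChannel ?_, ?_⟩
  · rw [Fintype.sum_sum_type]
    have h1 : ∀ i, (R (Sum.inl i))ᴴ * R (Sum.inl i) = ((s i : ℂ) * s i) • (W i * (W i)ᴴ) := by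
      intro i
      simp only [R, Sum.elim_inl, conjTranspose_smul, conjTranspose_mul,
        conjTranspose_conjTranspose, Matrix.smul_mul, Matrix.mul_smul, smul_smul]
      rw [Matrix.mul_assoc, ← Matrix.mul_assoc Pᴴ, hP, Matrix.one_mul]
      simp
    have h2 : ∀ b, (R (Sum.inr b))ᴴ * R (Sum.inr b) = Qᴴ * single b b 1 * Q := by
      intro b
      simp only [R, Sum.elim_inr, conjTranspose_mul, Matrix.mul_assoc]
      rw [← Matrix.mul_assoc (single a₀ b 1)ᴴ, conjTranspose_single, star_one,
        single_mul_single_same, one_mul]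
    simp only [h1, h2]
    have h3 : ∑ b : B, single b b (1 : ℂ) = 1 := by
      ext i j
      simp [Matrix.sum_apply, single_apply, one_apply, ite_and]
    rw [← Matrix.sum_mul, ← Matrix.mul_sum, h3, Matrix.mul_one, hQQ]
    simp [Q, N]
  · intro σ
    have hX : ∀ i, K i * (P * σ * Pᴴ) * (K i)ᴴ = W i * σ * (W i)ᴴ := fun i => by
      simp only [W, conjTranspose_mul, Matrix.mul_assoc]
    simp only [hX]
    rw [hΘ, Fintype.sum_sum_type]
    have h1 : ∀ i j, R (Sum.inl i) * W j = if i = j then ((s i * μ i : ℝ) : ℂ) • P else 0 := by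
      intro i j
      simp only [R, Sum.elim_inl, Matrix.smul_mul, Matrix.mul_assoc, hW]
      split_ifs
      · rw [Matrix.mul_smul, Matrix.mul_one, smul_smul]
        simp
      · simp
    have h2 : ∀ b j, R (Sum.inr b) * W j = 0 := fun b j => by
      simp only [R, Sum.elim_inr, Matrix.mul_assoc, hQW, Matrix.mul_zero]
    have h3 : ∀ r, R r * (∑ i, W i * σ * (W i)ᴴ) * (R r)ᴴ =
        ∑ i, (R r * W i) * σ * (R r * W i)ᴴ := fun r => by
      simp only [Matrix.mul_sum, Matrix.sum_mul, conjTranspose_mul, Matrix.mul_assoc]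
    simp only [h3, h1, h2]
    have h4 : ∀ i, s i * μ i * (s i * μ i) = μ i := by
      intro i
      rcases eq_or_ne (μ i) 0 with h0 | h0
      · simp [h0]
      · simp only [s]
        have := Real.mul_self_sqrt (hμ i)
        have h5 : Real.sqrt (μ i) ≠ 0 := (Real.sqrt_ne_zero (hμ i)).2 h0
        field_simp
        nlinarith [this]
    have h5 : ∀ i j, (if i = j then ((s i * μ i : ℝ) : ℂ) • P else 0) * σ *
        (if i = j then ((s i * μ i : ℝ) : ℂ) • P else 0)ᴴ =
        if i = j then ((μ i : ℝ) : ℂ) • (P * σ * Pᴴ) else 0 := by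
      intro i j
      split_ifs
      · simp only [conjTranspose_smul, Matrix.smul_mul, Matrix.mul_smul, smul_smul]
        congr 1
        conv_rhs => rw [← h4 i]
        simp
      · simp
    simp only [h5]
    simp only [Finset.sum_ite_eq, Finset.mem_univ, if_true, Matrix.zero_mul,
      Finset.sum_const_zero, add_zero]
    rw [← Finset.sum_smul, ← Complex.ofReal_sum, hμ1, Complex.ofReal_one, one_smul]

/-- Sufficiency of the Knill–Laflamme conditions: if the columns of `P` are an orthonormal system
and each `P* (K e)* (K f) P` is a scalar matrix, then the range of `P` is an error correcting
code. Diagonalizing the Hermitian matrix of these scalars reduces to orthogonal Kraus operators. -/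
theorem isErrorCorrectingCode_range {A B ι κ : Type*} [Fintype A] [Fintype B] [Fintype ι]
    [Fintype κ] [DecidableEq A] [DecidableEq κ] [Nonempty κ]
    {Φ : Matrix A A ℂ →ₗ[ℂ] Matrix B B ℂ} {K : ι → Matrix B A ℂ} (hK : HasKraus Φ K)
    (hΦ : ∀ ρ, (Φ ρ).trace = ρ.trace) {P : Matrix A κ ℂ} (hP : Pᴴ * P = 1)
    (h : ∀ e f, ∃ c : ℂ, Pᴴ * ((K e)ᴴ * K f) * P = c • 1) :
    IsErrorCorrectingCode Φ (LinearMap.range (toEuclideanLin P)) := by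
  classical
  choose L hL using h
  obtain ⟨k₀⟩ := ‹Nonempty κ›
  have hL0 : ∀ e f, L e f = (Pᴴ * ((K e)ᴴ * K f) * P) k₀ k₀ := fun e f => by simp [hL]
  have hLH : (Matrix.of L).IsHermitian := by
    ext e f
    rw [conjTranspose_apply, of_apply, of_apply, hL0, hL0, ← conjTranspose_apply]
    simp only [conjTranspose_mul, conjTranspose_conjTranspose, Matrix.mul_assoc]
  let U : Matrix ι ι ℂ := hLH.eigenvectorUnitary
  have hUU : U * Uᴴ = 1 := Unitary.coe_mul_star_self hLH.eigenvectorUnitary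
  have hdiag : Uᴴ * Matrix.of L * U = diagonal fun i => (hLH.eigenvalues i : ℂ) := by
    have := hLH.conjStarAlgAut_star_eigenvectorUnitary
    rw [Unitary.conjStarAlgAut_star_apply] at this
    exact this
  let K' : ι → Matrix B A ℂ := fun i => ∑ e, U e i • K e
  have hK' : HasKraus Φ K' := hK.unitary_mix hUU
  have hK'1 := hK'.sum_conjTranspose_mul_self hΦ
  have hgram : ∀ i j, (K' i * P)ᴴ * (K' j * P) =
      if i = j then (hLH.eigenvalues i : ℂ) • 1 else 0 := by
    intro i j
    have h1 : (K' i * P)ᴴ * (K' j * P) = (Uᴴ * Matrix.of L * U) i j • 1 := by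
      have h2 : (K' i * P)ᴴ * (K' j * P) =
          ∑ f, ∑ e, (star (U e i) * U f j) • (Pᴴ * ((K e)ᴴ * K f) * P) := by
        simp only [K', conjTranspose_mul, conjTranspose_sum, conjTranspose_smul, Matrix.sum_mul,
          Matrix.mul_sum, Matrix.smul_mul, Matrix.mul_smul, smul_smul, Matrix.mul_assoc,
          Finset.smul_sum]
        simp only [mul_comm]
      rw [h2]
      simp only [hL, smul_smul, mul_apply, of_apply, conjTranspose_apply, Finset.sum_mul,
        Finset.sum_smul]
      refine Finset.sum_congr rfl fun f _ => Finset.sum_congr rfl fun e _ => ?_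
      congr 1
      ring
    rw [h1, hdiag, diagonal_apply]
    split_ifs <;> simp
  have hev : ∀ i, ((hLH.eigenvalues i : ℝ) : ℂ) = ((K' i * P)ᴴ * (K' i * P)) k₀ k₀ := fun i => by
    rw [hgram, if_pos rfl]
    simp
  have hnn : ∀ i, 0 ≤ hLH.eigenvalues i := by
    intro i
    have := (posSemidef_conjTranspose_mul_self (K' i * P)).diag_nonneg (i := k₀)
    rw [← hev] at this
    exact_mod_cast this
  have hsum : ∑ i, hLH.eigenvalues i = 1 := by
    have h1 : ((∑ i, hLH.eigenvalues i : ℝ) : ℂ) = 1 := by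
      push_cast
      simp only [hev]
      rw [← Matrix.sum_apply]
      have : ∀ i, (K' i * P)ᴴ * (K' i * P) = Pᴴ * ((K' i)ᴴ * K' i) * P := fun i => by
        simp only [conjTranspose_mul, Matrix.mul_assoc]
      simp only [this]
      rw [← Matrix.sum_mul, ← Matrix.mul_sum, hK'1, Matrix.mul_one, hP, one_apply_eq]
    exact_mod_cast h1
  have hA : Nonempty A := by
    by_contra hA
    rw [not_nonempty_iff] at hA
    have := congrFun (congrFun hP k₀) k₀
    simp [mul_apply] at this
  obtain ⟨Θ, hΘ, hrec⟩ := exists_recovery_of_diagonal hP hnn hsum hgram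
  refine ⟨Θ, hΘ, fun ρ hρ => ?_⟩
  have h1 : P * Pᴴ * ρ = ρ := by
    ext a a'
    obtain ⟨x, hx⟩ := hρ.2.2 ⟨WithLp.toLp 2 (Pi.single a' 1), rfl⟩
    have hx' : P *ᵥ x.ofLp = ρ *ᵥ Pi.single a' 1 := by
      simpa [toLpLin_apply] using congrArg WithLp.ofLp hx
    have h2 : (P * Pᴴ) *ᵥ (ρ *ᵥ Pi.single a' 1) = ρ *ᵥ Pi.single a' 1 := by
      rw [← hx', mulVec_mulVec, Matrix.mul_assoc, hP, Matrix.mul_one]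
    rw [mulVec_mulVec] at h2
    simpa using congrFun h2 a
  have h2 : ρ * (P * Pᴴ) = ρ := by
    have := congrArg conjTranspose h1
    rwa [conjTranspose_mul, hρ.1.isHermitian.eq, conjTranspose_mul, conjTranspose_conjTranspose]
      at this
  have h3 : ρ = P * (Pᴴ * ρ * P) * Pᴴ := by
    conv_lhs => rw [← h2, ← h1]
    simp only [Matrix.mul_assoc]
  rw [hK' ρ, h3]
  exact hrec _

/-! ### Tensor products of matrices -/

/-- The tensor product `M₁ ⊗ ⋯ ⊗ Mₙ`. -/
def tensorMatrix {A B : Type*} {n : ℕ} (M : Fin n → Matrix B A ℂ) :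
    Matrix (Fin n → B) (Fin n → A) ℂ :=
  Matrix.of fun b a => ∏ i, M i (b i) (a i)

theorem tensorMatrix_conjTranspose {A B : Type*} {n : ℕ} (M : Fin n → Matrix B A ℂ) :
    (tensorMatrix M)ᴴ = tensorMatrix fun i => (M i)ᴴ := by
  ext a b
  simp [tensorMatrix]

theorem prod_sum_eq {S : Type*} [Fintype S] {n : ℕ} (g : Fin n → S → ℂ) :
    ∏ i, ∑ s, g i s = ∑ s : Fin n → S, ∏ i, g i (s i) := by
  classical
  rw [Finset.prod_univ_sum, Fintype.piFinset_univ]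

theorem tensorMatrix_mul {A B C : Type*} [Fintype B] {n : ℕ} (M : Fin n → Matrix A B ℂ)
    (N : Fin n → Matrix B C ℂ) :
    tensorMatrix M * tensorMatrix N = tensorMatrix fun i => M i * N i := by
  ext a c
  simp only [tensorMatrix, mul_apply, of_apply, prod_sum_eq, Finset.prod_mul_distrib]

theorem tensorMatrix_sum {A B S : Type*} [Fintype S] {n : ℕ} (M : Fin n → S → Matrix A B ℂ) :
    tensorMatrix (fun i => ∑ s, M i s) = ∑ s : Fin n → S, tensorMatrix fun i => M i (s i) := by
  ext a b
  simp only [tensorMatrix, Matrix.sum_apply, of_apply, prod_sum_eq]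

theorem tensorMatrix_smul {A B : Type*} {n : ℕ} (c : Fin n → ℂ) (M : Fin n → Matrix A B ℂ) :
    tensorMatrix (fun i => c i • M i) = (∏ i, c i) • tensorMatrix M := by
  ext a b
  simp [tensorMatrix, Finset.prod_mul_distrib]

theorem tensorMatrix_one {A : Type*} [DecidableEq A] {n : ℕ} :
    tensorMatrix (fun _ : Fin n => (1 : Matrix A A ℂ)) = 1 := by
  ext a b
  simp only [tensorMatrix, of_apply, one_apply, Finset.prod_ite_zero, Finset.prod_const_one,
    funext_iff, Finset.mem_univ, forall_true_left]

theorem HasKraus.tensorPower {A B ι : Type*} [Fintype A] [Fintype ι] [DecidableEq A]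
    {Φ : Matrix A A ℂ →ₗ[ℂ] Matrix B B ℂ} {K : ι → Matrix B A ℂ} (h : HasKraus Φ K) (n : ℕ) :
    HasKraus (tensorPower n Φ) fun e : Fin n → ι => tensorMatrix fun i => K (e i) := by
  refine hasKraus_of_single fun a a' b b' => ?_
  have h1 : QZE.tensorPower n Φ (single a a' 1) b b' =
      ∏ i, Φ (single (a i) (a' i) 1) (b i) (b' i) := by
    simp only [QZE.tensorPower, LinearMap.coe_mk, AddHom.coe_mk, of_apply]
    rw [Finset.sum_eq_single a, Finset.sum_eq_single a']
    · simp
    · intro x _ hx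
      simp [hx.symm]
    · simp
    · intro x _ hx
      simp [hx.symm]
    · simp
  rw [h1]
  simp only [h.apply_single, prod_sum_eq, tensorMatrix, of_apply, star_prod,
    Finset.prod_mul_distrib]

/-- A channel has Kraus operators `K e` whose products `(K e)* (K f)` span its noncommutative
graph. -/
theorem HasNoncommutativeGraph.exists_hasKraus {A B : Type*} [Fintype A] [Fintype B]
    [DecidableEq A] {Φ : Matrix A A ℂ →ₗ[ℂ] Matrix B B ℂ} {L : Set (Matrix A A ℂ)}
    (h : HasNoncommutativeGraph Φ L) :
    ∃ (d : ℕ) (K : Fin d → Matrix B A ℂ), HasKraus Φ K ∧ ∑ e, (K e)ᴴ * K e = 1 ∧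
      (∀ e f, (K e)ᴴ * K f ∈ L) ∧
      ∀ M ∈ L, ∃ X : Fin d × Fin d → ℂ, M = ∑ t, X t • ((K t.1)ᴴ * K t.2) := by
  obtain ⟨d, V, ⟨hV, hΦ⟩, rfl⟩ := h
  let K : Fin d → Matrix B A ℂ := fun e => Matrix.of fun b a => V (b, e) a
  have hdual : ∀ X : Matrix (Fin d) (Fin d) ℂ, dualMap (complementary V) X =
      ∑ t : Fin d × Fin d, X t.1 t.2 • ((K t.1)ᴴ * K t.2) := by
    intro X
    ext i j
    have hc : ∀ f e, complementary V (single j i 1) f e =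
        ∑ b, V (b, f) j * star (V (b, e) i) := fun f e => by
      simp only [complementary, LinearMap.coe_mk, AddHom.coe_mk, of_apply, mul_single_mul_apply]
    simp only [dualMap, LinearMap.coe_mk, AddHom.coe_mk, of_apply, trace, diag, hc,
      Matrix.sum_apply, Matrix.smul_apply, mul_apply, conjTranspose_apply, K, smul_eq_mul,
      Fintype.sum_prod_type]
    refine Finset.sum_congr rfl fun e _ => Finset.sum_congr rfl fun f _ => ?_
    congr 1
    exact Finset.sum_congr rfl fun b _ => mul_comm _ _
  refine ⟨d, K, fun ρ => ?_, ?_, fun e f => ⟨single e f 1, ?_⟩, ?_⟩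
  · rw [hΦ]
    ext b b'
    simp only [traceRight, of_apply, Matrix.sum_apply, mul_apply, conjTranspose_apply, K]
  · rw [← hV]
    ext i j
    simp only [Matrix.sum_apply, mul_apply, conjTranspose_apply, K, of_apply,
      Fintype.sum_prod_type]
    rw [Finset.sum_comm]
  · rw [hdual, Finset.sum_eq_single (e, f)]
    · simp
    · rintro ⟨e', f'⟩ _ hne
      have : ¬ (e = e' ∧ f = f') := fun hh => hne (by rw [hh.1, hh.2])
      simp [this]
    · simp
  · rintro _ ⟨X, rfl⟩
    exact ⟨fun t => X t.1 t.2, hdual X⟩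

/-! ### Schur multipliers close to the all-ones matrix -/

/-- `M` is a combination of matrices `(u i * w j)` with `|u i|, |w j| ≤ 1`, with coefficients whose
absolute values add up to at most `x`. The Schur multiplication by each of these rank one matrices
is `X ↦ diag(u) X diag(w)`, so that `x` bounds the completely bounded norm of the Schur
multiplication by `M`. -/
def SchurBound {A : Type*} (x : ℝ) (M : Matrix A A ℂ) : Prop :=
  ∃ (S : Type) (_ : Fintype S) (c : S → ℂ) (u w : S → A → ℂ),
    (∀ s a, ‖u s a‖ ≤ 1) ∧ (∀ s a, ‖w s a‖ ≤ 1) ∧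
    (∀ i j, M i j = ∑ s, c s * u s i * w s j) ∧ ∑ s, ‖c s‖ ≤ x

namespace SchurBound

variable {A : Type*} {x y : ℝ} {M N : Matrix A A ℂ}

theorem mono (h : SchurBound x M) (hxy : x ≤ y) : SchurBound y M := by
  obtain ⟨S, _, c, u, w, hu, hw, hM, hc⟩ := h
  exact ⟨S, _, c, u, w, hu, hw, hM, hc.trans hxy⟩

theorem rankOne (c : ℂ) {u w : A → ℂ} (hu : ∀ a, ‖u a‖ ≤ 1) (hw : ∀ a, ‖w a‖ ≤ 1) :
    SchurBound ‖c‖ (Matrix.of fun i j => c * u i * w j) :=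
  ⟨Unit, inferInstance, fun _ => c, fun _ => u, fun _ => w, fun _ => hu, fun _ => hw,
    fun i j => by simp, by simp⟩

theorem zero : SchurBound 0 (0 : Matrix A A ℂ) :=
  ⟨Empty, inferInstance, Empty.elim, fun s => s.elim, fun s => s.elim, fun s => s.elim,
    fun s => s.elim, by simp, by simp⟩

theorem add (hM : SchurBound x M) (hN : SchurBound y N) : SchurBound (x + y) (M + N) := by
  obtain ⟨S, _, c, u, w, hu, hw, hM, hc⟩ := hM
  obtain ⟨T, _, d, v, z, hv, hz, hN, hd⟩ := hN
  refine ⟨S ⊕ T, inferInstance, Sum.elim c d, Sum.elim u v, Sum.elim w z, ?_, ?_, ?_, ?_⟩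
  · rintro (s | s) <;> simp [hu, hv]
  · rintro (s | s) <;> simp [hw, hz]
  · intro i j
    simp [hM, hN]
  · simpa using add_le_add hc hd

theorem sum {ι : Type*} (s : Finset ι) {X : ι → ℝ} {F : ι → Matrix A A ℂ}
    (h : ∀ i ∈ s, SchurBound (X i) (F i)) : SchurBound (∑ i ∈ s, X i) (∑ i ∈ s, F i) := by
  classical
  induction s using Finset.induction_on with
  | empty => simpa using zero
  | insert a s ha ih =>
    rw [Finset.sum_insert ha, Finset.sum_insert ha]
    exact (h a (Finset.mem_insert_self a s)).add
      (ih fun i hi => h i (Finset.mem_insert_of_mem hi))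

theorem hadamard (hM : SchurBound x M) (hN : SchurBound y N) :
    SchurBound (x * y) (Matrix.hadamard M N) := by
  obtain ⟨S, _, c, u, w, hu, hw, hM, hc⟩ := hM
  obtain ⟨T, _, d, v, z, hv, hz, hN, hd⟩ := hN
  refine ⟨S × T, inferInstance, fun t => c t.1 * d t.2, fun t a => u t.1 a * v t.2 a,
    fun t a => w t.1 a * z t.2 a, ?_, ?_, ?_, ?_⟩
  · intro t a
    rw [norm_mul]
    exact mul_le_one₀ (hu _ _) (norm_nonneg _) (hv _ _)
  · intro t a
    rw [norm_mul]
    exact mul_le_one₀ (hw _ _) (norm_nonneg _) (hz _ _)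
  · intro i j
    rw [hadamard_apply, hM, hN, Finset.sum_mul_sum, Fintype.sum_prod_type]
    refine Finset.sum_congr rfl fun s _ => Finset.sum_congr rfl fun t _ => ?_
    ring
  · simp only [norm_mul, Fintype.sum_prod_type, ← Finset.mul_sum, ← Finset.sum_mul]
    exact mul_le_mul hc hd (Finset.sum_nonneg fun _ _ => norm_nonneg _)
      ((Finset.sum_nonneg fun _ _ => norm_nonneg _).trans hc)

theorem smul (c : ℂ) (hM : SchurBound x M) : SchurBound (‖c‖ * x) (c • M) := by
  obtain ⟨S, _, d, u, w, hu, hw, hM, hc⟩ := hM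
  refine ⟨S, inferInstance, fun s => c * d s, u, w, hu, hw, ?_, ?_⟩
  · intro i j
    simp only [Matrix.smul_apply, hM, smul_eq_mul, Finset.mul_sum, mul_assoc]
  · simp only [norm_mul, ← Finset.mul_sum]
    exact mul_le_mul_of_nonneg_left hc (norm_nonneg _)

theorem submatrix {C : Type*} (hM : SchurBound x M) (f : C → A) :
    SchurBound x (M.submatrix f f) := by
  obtain ⟨S, _, c, u, w, hu, hw, hM, hc⟩ := hM
  exact ⟨S, inferInstance, c, fun s a => u s (f a), fun s a => w s (f a), fun s a => hu s _,
    fun s a => hw s _, fun i j => hM _ _, hc⟩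

/-- If `D` deviates from the all-ones matrix by `x`, then `D ⊗ ⋯ ⊗ D` deviates by at most
`(1 + x)ⁿ - 1`. -/
theorem tensorMatrix_sub_one {n : ℕ} {D : Matrix A A ℂ}
    (h : SchurBound x (Matrix.of fun i j => D i j - 1)) :
    SchurBound ((1 + x) ^ n - 1)
      (Matrix.of fun a b : Fin n → A => tensorMatrix (fun _ : Fin n => D) a b - 1) := by
  have key : ∀ s : Finset (Fin n), SchurBound ((1 + x) ^ s.card - 1)
      (Matrix.of fun a b : Fin n → A => ∏ i ∈ s, D (a i) (b i) - 1) := by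
    intro s
    induction s using Finset.induction_on with
    | empty =>
      convert zero using 1
      · simp
      · ext a b
        simp
    | insert i s hi ih =>
      have h1 := h.submatrix fun a : Fin n → A => a i
      have h2 := (ih.hadamard h1).add (ih.add h1)
      rw [Finset.card_insert_of_notMem hi]
      convert h2 using 1
      · ring
      · ext a b
        simp only [of_apply, Finset.prod_insert hi, Matrix.add_apply, hadamard_apply,
          submatrix_apply]
        ring
  simpa [tensorMatrix] using key Finset.univ

end SchurBound

/-- `h` is a Parseval system: the rank one matrices `h k (h k)*` add up to the identity. -/
def IsParseval {A κ : Type*} [Fintype κ] [DecidableEq A] (h : κ → A → ℂ) : Prop :=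
  ∀ i j, ∑ k, h k i * star (h k j) = if i = j then 1 else 0

theorem IsParseval.sum_norm_sq {A κ : Type*} [Fintype A] [Fintype κ] [DecidableEq A]
    {h : κ → A → ℂ} (hh : IsParseval h) (v : A → ℂ) :
    ∑ k, ‖∑ i, v i * h k i‖ ^ 2 = ∑ i, ‖v i‖ ^ 2 := by
  have h1 : ((∑ k, ‖∑ i, v i * h k i‖ ^ 2 : ℝ) : ℂ) = ((∑ i, ‖v i‖ ^ 2 : ℝ) : ℂ) := by
    push_cast
    simp only [← Complex.mul_conj', map_sum, map_mul, Finset.sum_mul_sum]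
    rw [Finset.sum_comm]
    refine Finset.sum_congr rfl fun i _ => ?_
    rw [Finset.sum_comm]
    have h2 : ∀ j, ∑ k, v i * h k i * ((starRingEnd ℂ) (v j) * (starRingEnd ℂ) (h k j)) =
        v i * (starRingEnd ℂ) (v j) * if i = j then 1 else 0 := by
      intro j
      rw [← hh i j, Finset.mul_sum]
      refine Finset.sum_congr rfl fun k _ => ?_
      rw [← starRingEnd_apply]
      ring
    simp [h2]
  exact_mod_cast h1

theorem IsParseval.tensor {A κ : Type*} [Fintype κ] [DecidableEq A] {h : κ → A → ℂ}
    (hh : IsParseval h) (n : ℕ) :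
    IsParseval fun (k : Fin n → κ) (a : Fin n → A) => ∏ i, h (k i) (a i) := by
  intro a b
  simp only [star_prod, ← Finset.prod_mul_distrib]
  rw [← prod_sum_eq fun i k => h k (a i) * star (h k (b i))]
  simp only [hh _ _, Finset.prod_ite_zero, Finset.prod_const_one, funext_iff, Finset.mem_univ,
    forall_true_left]

/-- The Schur product of `M` with the rank one matrices `h k (h k)*` of a Parseval system, tested
against unit vectors. -/
theorem SchurBound.sum_norm_le {A κ : Type*} [Fintype A] [Fintype κ] [DecidableEq A]
    {h : κ → A → ℂ} (hh : IsParseval h) {x : ℝ} {M : Matrix A A ℂ} (hM : SchurBound x M)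
    {φ ψ : A → ℂ} (hφ : ∑ i, ‖φ i‖ ^ 2 = 1) (hψ : ∑ i, ‖ψ i‖ ^ 2 = 1) :
    ∑ k, ‖∑ i, ∑ j, star (φ i) * (M i j * (h k i * star (h k j))) * ψ j‖ ≤ x := by
  obtain ⟨S, _, c, u, w, hu, hw, hM, hc⟩ := hM
  let α : S → κ → ℂ := fun s k => ∑ i, star (φ i) * u s i * h k i
  let β : S → κ → ℂ := fun s k => ∑ j, star (ψ j) * star (w s j) * h k j
  have hle : ∀ {v z : A → ℂ}, ∑ i, ‖v i‖ ^ 2 = 1 → (∀ i, ‖z i‖ ≤ 1) →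
      ∑ i, ‖star (v i) * z i‖ ^ 2 ≤ 1 := by
    intro v z hv hz
    rw [← hv]
    refine Finset.sum_le_sum fun i _ => ?_
    rw [norm_mul, norm_star]
    exact pow_le_pow_left₀ (by positivity)
      (mul_le_of_le_one_right (norm_nonneg _) (hz i)) 2
  have hα : ∀ s, ∑ k, ‖α s k‖ ^ 2 ≤ 1 := fun s => by
    rw [hh.sum_norm_sq]
    exact hle hφ (hu s)
  have hβ : ∀ s, ∑ k, ‖β s k‖ ^ 2 ≤ 1 := fun s => by
    rw [hh.sum_norm_sq]
    exact hle hψ fun i => by rw [norm_star]; exact hw s i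
  have hαβ : ∀ s, ∑ k, ‖α s k‖ * ‖β s k‖ ≤ 1 := fun s => by
    have h1 : ∑ k, ‖α s k‖ * ‖β s k‖ ≤ ∑ k, (‖α s k‖ ^ 2 + ‖β s k‖ ^ 2) / 2 :=
      Finset.sum_le_sum fun k _ => by nlinarith [sq_nonneg (‖α s k‖ - ‖β s k‖)]
    rw [← Finset.sum_div, Finset.sum_add_distrib] at h1
    linarith [hα s, hβ s]
  have hexp : ∀ k, ∑ i, ∑ j, star (φ i) * (M i j * (h k i * star (h k j))) * ψ j =
      ∑ s, c s * (α s k * star (β s k)) := by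
    intro k
    simp only [α, β, hM, star_sum, star_mul', star_star, Finset.mul_sum, Finset.sum_mul]
    rw [Finset.sum_comm_cycle]
    refine Finset.sum_congr rfl fun s _ => ?_
    rw [Finset.sum_comm]
    refine Finset.sum_congr rfl fun i _ => Finset.sum_congr rfl fun j _ => ?_
    ring
  calc ∑ k, ‖∑ i, ∑ j, star (φ i) * (M i j * (h k i * star (h k j))) * ψ j‖
      ≤ ∑ k, ∑ s, ‖c s‖ * (‖α s k‖ * ‖β s k‖) := by
        refine Finset.sum_le_sum fun k _ => ?_
        rw [hexp]
        refine (norm_sum_le _ _).trans (le_of_eq ?_)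
        simp only [norm_mul, norm_star]
    _ = ∑ s, ‖c s‖ * ∑ k, ‖α s k‖ * ‖β s k‖ := by
        rw [Finset.sum_comm]
        simp only [Finset.mul_sum]
    _ ≤ ∑ s, ‖c s‖ := Finset.sum_le_sum fun s _ =>
        mul_le_of_le_one_right (norm_nonneg _) (hαβ s)
    _ ≤ x := hc

/-- If the Schur multiplier `D` deviates from the all-ones matrix by less than `1/2`, then the
Knill–Laflamme conditions for the operators `D ∘ (h k (h k)*)` have no solution: for `D` equal to
the all-ones matrix they say that the coefficients `a k`, `b k` of `φ`, `ψ` in the system `h`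
satisfy `a k * b k = 0` and `|a k| = |b k|`, which contradicts `∑ |a k|² = 1`. -/
theorem not_knillLaflamme_of_schurBound {A κ : Type*} [Fintype A] [Fintype κ] [DecidableEq A]
    {h : κ → A → ℂ} (hh : IsParseval h) {x : ℝ} (hx : x < 1 / 2) {D : Matrix A A ℂ}
    (hD : SchurBound x (Matrix.of fun i j => D i j - 1))
    {φ ψ : A → ℂ} (hφ : ∑ i, ‖φ i‖ ^ 2 = 1) (hψ : ∑ i, ‖ψ i‖ ^ 2 = 1)
    (h0 : ∀ k, ∑ i, ∑ j, star (φ i) * (D i j * (h k i * star (h k j))) * ψ j = 0)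
    (h1 : ∀ k, ∑ i, ∑ j, star (φ i) * (D i j * (h k i * star (h k j))) * φ j =
      ∑ i, ∑ j, star (ψ i) * (D i j * (h k i * star (h k j))) * ψ j) : False := by
  let a : (A → ℂ) → κ → ℂ := fun φ k => ∑ i, star (φ i) * h k i
  let r : (A → ℂ) → (A → ℂ) → κ → ℂ := fun φ ψ k =>
    ∑ i, ∑ j, star (φ i) * ((D i j - 1) * (h k i * star (h k j))) * ψ j
  have hsplit : ∀ (φ ψ : A → ℂ) k,
      ∑ i, ∑ j, star (φ i) * (D i j * (h k i * star (h k j))) * ψ j =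
        a φ k * star (a ψ k) + r φ ψ k := by
    intro φ ψ k
    simp only [a, r, star_sum, star_mul', star_star, Finset.sum_mul_sum,
      ← Finset.sum_add_distrib]
    refine Finset.sum_congr rfl fun i _ => Finset.sum_congr rfl fun j _ => ?_
    ring
  have ha : ∀ {φ : A → ℂ}, ∑ i, ‖φ i‖ ^ 2 = 1 → ∑ k, ‖a φ k‖ ^ 2 = 1 := by
    intro φ hφ
    rw [hh.sum_norm_sq, ← hφ]
    simp only [norm_star]
  have hr : ∀ {φ ψ : A → ℂ}, ∑ i, ‖φ i‖ ^ 2 = 1 → ∑ i, ‖ψ i‖ ^ 2 = 1 →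
      ∑ k, ‖r φ ψ k‖ ≤ x := fun hφ hψ => hD.sum_norm_le hh hφ hψ
  have hprod : ∀ k, ‖a φ k‖ * ‖a ψ k‖ = ‖r φ ψ k‖ := by
    intro k
    have h2 := h0 k
    rw [hsplit] at h2
    rw [eq_neg_of_add_eq_zero_right h2, norm_neg, norm_mul, norm_star]
  have hdiff : ∀ k, |‖a φ k‖ ^ 2 - ‖a ψ k‖ ^ 2| ≤ ‖r φ φ k‖ + ‖r ψ ψ k‖ := by
    intro k
    have h2 := h1 k
    rw [hsplit, hsplit] at h2
    have h3 : ((‖a φ k‖ ^ 2 - ‖a ψ k‖ ^ 2 : ℝ) : ℂ) = r ψ ψ k - r φ φ k := by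
      push_cast
      rw [← Complex.mul_conj', ← Complex.mul_conj', starRingEnd_apply, starRingEnd_apply]
      linear_combination h2
    rw [← Real.norm_eq_abs, ← Complex.norm_real, h3, add_comm]
    exact norm_sub_le _ _
  have hk : ∀ k, ‖a φ k‖ ^ 2 + ‖a ψ k‖ ^ 2 ≤
      ‖r φ φ k‖ + ‖r ψ ψ k‖ + 2 * ‖r φ ψ k‖ := by
    intro k
    have h2 := hdiff k
    rw [← hprod]
    have h3 := norm_nonneg (a φ k)
    have h4 := norm_nonneg (a ψ k)
    rw [abs_le] at h2
    rcases le_total ‖a φ k‖ ‖a ψ k‖ with h5 | h5 <;> nlinarith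
  have hs := Finset.sum_le_sum fun k (_ : k ∈ Finset.univ) => hk k
  simp only [Finset.sum_add_distrib, ← Finset.mul_sum] at hs
  have := ha hφ
  have := ha hψ
  have := hr hφ hφ
  have := hr hψ hψ
  have := hr hφ hψ
  linarith

/-- The Knill–Laflamme conditions for a code of `Φ ⊗ ⋯ ⊗ Φ`, tested on tensor products of operators
of the noncommutative graph. -/
theorem IsErrorCorrectingCode.knillLaflamme_tensor {A B : Type*} [Fintype A] [Fintype B]
    [DecidableEq A] {Φ : Matrix A A ℂ →ₗ[ℂ] Matrix B B ℂ} {L : Set (Matrix A A ℂ)}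
    (hL : HasNoncommutativeGraph Φ L) {n : ℕ} {H : Submodule ℂ (EuclideanSpace ℂ (Fin n → A))}
    (hH : IsErrorCorrectingCode (tensorPower n Φ) H)
    {φ ψ : (Fin n → A) → ℂ} (hφH : WithLp.toLp 2 φ ∈ H) (hψH : WithLp.toLp 2 ψ ∈ H)
    (hφ : star φ ⬝ᵥ φ = 1) (hψ : star ψ ⬝ᵥ ψ = 1) (hφψ : star φ ⬝ᵥ ψ = 0)
    {M : Fin n → Matrix A A ℂ} (hM : ∀ i, M i ∈ L) :
    star φ ⬝ᵥ tensorMatrix M *ᵥ ψ = 0 ∧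
      star φ ⬝ᵥ tensorMatrix M *ᵥ φ = star ψ ⬝ᵥ tensorMatrix M *ᵥ ψ := by
  obtain ⟨d, K, hK, -, -, hspan⟩ := hL.exists_hasKraus
  choose X hX using fun i => hspan _ (hM i)
  have h1 : tensorMatrix M = ∑ t : Fin n → Fin d × Fin d, (∏ i, X i (t i)) •
      ((tensorMatrix fun i => K (t i).1)ᴴ * tensorMatrix fun i => K (t i).2) := by
    rw [funext hX, tensorMatrix_sum]
    simp only [tensorMatrix_smul, tensorMatrix_conjTranspose, tensorMatrix_mul]
  have h2 := fun t : Fin n → Fin d × Fin d => hH.knillLaflamme (hK.tensorPower n) hφH hψH hφ hψ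
    hφψ (fun i => (t i).1) (fun i => (t i).2)
  simp only [h1, Matrix.sum_mulVec, dotProduct_sum, smul_mulVec, dotProduct_smul, (h2 _).1,
    (h2 _).2, smul_zero, Finset.sum_const_zero, and_self]

/-- The one-shot capacity of `Φ ⊗ ⋯ ⊗ Φ` vanishes if the noncommutative graph of `Φ` contains the
Schur products of the projections of a Parseval system with a matrix close to the all-ones
matrix. -/
theorem oneShotCapacity_tensorPower_eq_zero {A B κ : Type*} [Fintype A] [Fintype B] [Fintype κ]
    [DecidableEq A] {Φ : Matrix A A ℂ →ₗ[ℂ] Matrix B B ℂ} {L : Set (Matrix A A ℂ)}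
    (hL : HasNoncommutativeGraph Φ L) {h : κ → A → ℂ} (hh : IsParseval h) {D : Matrix A A ℂ}
    (hDL : ∀ k, D.hadamard (Matrix.of fun i j => h k i * star (h k j)) ∈ L) {x : ℝ} {n : ℕ}
    (hD : SchurBound x (Matrix.of fun i j => D i j - 1)) (hx : (1 + x) ^ n - 1 < 1 / 2) :
    oneShotCapacity (tensorPower n Φ) = 0 := by
  have hzero : ∀ r ∈ codeRates (tensorPower n Φ), r = 0 := by
    rintro r ⟨H, hH0, hH, rfl⟩
    have h1 := Submodule.one_le_finrank_iff.2 hH0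
    by_contra hne
    have h2 : 1 < Module.finrank ℂ H := by
      refine lt_of_le_of_ne h1 fun h3 => hne ?_
      rw [← h3]
      simp
    let b := stdOrthonormalBasis ℂ H
    have hb := orthonormal_iff_ite.1 b.orthonormal
    let φ : EuclideanSpace ℂ (Fin n → A) := b ⟨0, by omega⟩
    let ψ : EuclideanSpace ℂ (Fin n → A) := b ⟨1, h2⟩
    have hφ : star φ.ofLp ⬝ᵥ φ.ofLp = 1 := by
      have := hb ⟨0, by omega⟩ ⟨0, by omega⟩
      rw [if_pos rfl, Submodule.coe_inner, EuclideanSpace.inner_eq_star_dotProduct] at this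
      rw [dotProduct_comm]
      exact this
    have hψ : star ψ.ofLp ⬝ᵥ ψ.ofLp = 1 := by
      have := hb ⟨1, h2⟩ ⟨1, h2⟩
      rw [if_pos rfl, Submodule.coe_inner, EuclideanSpace.inner_eq_star_dotProduct] at this
      rw [dotProduct_comm]
      exact this
    have hφψ : star φ.ofLp ⬝ᵥ ψ.ofLp = 0 := by
      have := hb ⟨0, by omega⟩ ⟨1, h2⟩
      rw [if_neg (by simp), Submodule.coe_inner, EuclideanSpace.inner_eq_star_dotProduct] at this
      rw [dotProduct_comm]
      exact this
    have hnorm : ∀ χ : (Fin n → A) → ℂ, star χ ⬝ᵥ χ = 1 → ∑ i, ‖χ i‖ ^ 2 = 1 := by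
      intro χ hχ
      have h3 : ((∑ i, ‖χ i‖ ^ 2 : ℝ) : ℂ) = 1 := by
        rw [← hχ]
        push_cast
        exact Finset.sum_congr rfl fun i _ => (Complex.conj_mul' _).symm
      exact_mod_cast h3
    have hKL := fun k : Fin n → κ => hH.knillLaflamme_tensor hL (φ := φ.ofLp) (ψ := ψ.ofLp)
      (b ⟨0, by omega⟩).2 (b ⟨1, h2⟩).2 hφ hψ hφψ fun i => hDL (k i)
    have hexp : ∀ (k : Fin n → κ) (χ ω : (Fin n → A) → ℂ),
        ∑ i, ∑ j, star (χ i) * (tensorMatrix (fun _ : Fin n => D) i j *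
          ((∏ l, h (k l) (i l)) * star (∏ l, h (k l) (j l)))) * ω j =
        star χ ⬝ᵥ tensorMatrix (fun l =>
          D.hadamard (Matrix.of fun i j => h (k l) i * star (h (k l) j))) *ᵥ ω := by
      intro k χ ω
      simp only [dotProduct, mulVec, tensorMatrix, of_apply, hadamard_apply, Pi.star_apply,
        Finset.mul_sum, Finset.prod_mul_distrib, star_prod, mul_assoc]
    refine not_knillLaflamme_of_schurBound (hh.tensor n) hx hD.tensorMatrix_sub_one (hnorm _ hφ)
      (hnorm _ hψ) (fun k => ?_) (fun k => ?_)
    · rw [hexp]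
      exact (hKL k).1
    · rw [hexp, hexp]
      exact (hKL k).2
  rcases (codeRates (tensorPower n Φ)).eq_empty_or_nonempty with he | hne
  · rw [oneShotCapacity, he, Real.sSup_empty]
  · rw [oneShotCapacity, Set.eq_singleton_iff_nonempty_unique_mem.2 ⟨hne, hzero⟩, csSup_singleton]

/-! ### The deviation of `D(θ)` from the all-ones matrix -/

/-- The odd powers `exp ((2 k + 1) π i / N)` of the primitive `2N`-th root of unity, that is, the
`N`-th roots of `-1`. -/
def oddRoot (N k : ℕ) : ℂ := Complex.exp (((2 * k + 1) * Real.pi / N : ℝ) * Complex.I)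

theorem oddRoot_ne_zero (N k : ℕ) : oddRoot N k ≠ 0 := Complex.exp_ne_zero _

theorem norm_oddRoot (N k : ℕ) : ‖oddRoot N k‖ = 1 := Complex.norm_exp_ofReal_mul_I _

theorem oddRoot_pow_self {N : ℕ} (hN : N ≠ 0) (k : ℕ) : oddRoot N k ^ N = -1 := by
  rw [oddRoot, ← Complex.exp_nat_mul]
  have hN' : (N : ℂ) ≠ 0 := by exact_mod_cast hN
  have : (N : ℂ) * (((2 * k + 1) * Real.pi / N : ℝ) * Complex.I) =
      Real.pi * Complex.I + k * (2 * Real.pi * Complex.I) := by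
    push_cast
    field_simp
    ring
  rw [this, Complex.exp_add, Complex.exp_nat_mul_two_pi_mul_I, Complex.exp_pi_mul_I, mul_one]

theorem sum_oddRoot_zpow {N : ℕ} (hN : N ≠ 0) {t : ℤ} (ht : ¬ (N : ℤ) ∣ t) :
    ∑ k ∈ Finset.range N, oddRoot N k ^ t = 0 := by
  have hζ := Complex.isPrimitiveRoot_exp N hN
  obtain ⟨ζ, hζdef⟩ : ∃ ζ, ζ = Complex.exp (2 * Real.pi * Complex.I / N) := ⟨_, rfl⟩
  rw [← hζdef] at hζ
  have hN' : (N : ℂ) ≠ 0 := by exact_mod_cast hN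
  have h1 : ∀ k, oddRoot N k = ζ ^ k * oddRoot N 0 := by
    intro k
    rw [hζdef, ← Complex.exp_nat_mul, oddRoot, oddRoot, ← Complex.exp_add]
    congr 1
    push_cast
    field_simp
    ring
  have h2 : ∀ k, oddRoot N k ^ t = (ζ ^ t) ^ k * oddRoot N 0 ^ t := by
    intro k
    rw [h1, mul_zpow, ← zpow_natCast, ← zpow_natCast, ← _root_.zpow_mul, ← _root_.zpow_mul,
      mul_comm t]
  have hz1 : ζ ^ t ≠ 1 := fun h => ht ((hζ.zpow_eq_one_iff_dvd t).1 h)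
  have hzN : (ζ ^ t) ^ N = 1 := by
    rw [← zpow_natCast, ← _root_.zpow_mul, mul_comm, _root_.zpow_mul, zpow_natCast, hζ.pow_eq_one,
      _root_.one_zpow]
  rw [Finset.sum_congr rfl fun k _ => h2 k, ← Finset.sum_mul, geom_sum_eq hz1, hzN, sub_self,
    zero_div, zero_mul]

theorem not_dvd_of_lt {N : ℕ} {t : ℤ} (h0 : t ≠ 0) (h1 : -N < t) (h2 : t < N) :
    ¬ (N : ℤ) ∣ t := fun h => h0 (Int.eq_zero_of_abs_lt_dvd h (abs_lt.2 ⟨h1, h2⟩))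

theorem SchurBound.one (N : ℕ) : SchurBound 1 (1 : Matrix (Fin N) (Fin N) ℂ) := by
  rcases Nat.eq_zero_or_pos N with rfl | hN
  · rw [Subsingleton.elim (1 : Matrix (Fin 0) (Fin 0) ℂ) 0]
    exact SchurBound.zero.mono zero_le_one
  have hN' : (N : ℂ) ≠ 0 := by exact_mod_cast hN.ne'
  have h := SchurBound.sum (Finset.range N) fun k _ =>
    SchurBound.rankOne (A := Fin N) ((N : ℂ)⁻¹) (u := fun j => oddRoot N k ^ (j : ℤ))
      (w := fun j => oddRoot N k ^ (-(j : ℤ)))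
      (fun a => by rw [norm_zpow, norm_oddRoot, _root_.one_zpow])
      (fun a => by rw [norm_zpow, norm_oddRoot, _root_.one_zpow])
  convert h using 1
  · simp [hN.ne']
  · ext i j
    simp only [Matrix.sum_apply, of_apply, mul_assoc, ← zpow_add₀ (oddRoot_ne_zero _ _),
      ← Finset.mul_sum]
    rcases eq_or_ne i j with rfl | hij
    · simp [hN.ne']
    · have h1 : (i : ℕ) ≠ j := fun h => hij (Fin.ext h)
      rw [sum_oddRoot_zpow hN.ne' (not_dvd_of_lt (by omega) (by omega) (by omega)),
        one_apply_ne hij, mul_zero]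

/-- The matrix of the signs of `j - i`. -/
def signMatrix (N : ℕ) : Matrix (Fin N) (Fin N) ℂ :=
  Matrix.of fun i j => if i < j then 1 else if j < i then -1 else 0

/-- The eigenvalues `ω + ω² + ⋯ + ω^(N-1)` of the sign matrix, where `ω^N = -1`. -/
def signEigenvalue (N k : ℕ) : ℂ := ∑ l ∈ Finset.range (N - 1), oddRoot N k ^ ((l : ℤ) + 1)

theorem norm_signEigenvalue {N k : ℕ} (hk : k < N) :
    ‖signEigenvalue N k‖ = |Real.cot ((2 * k + 1) * Real.pi / (2 * N))| := by
  have hN : N ≠ 0 := by omega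
  have hN0 : (0 : ℝ) < N := by exact_mod_cast hN.bot_lt
  set β : ℝ := (2 * k + 1) * Real.pi / (2 * N) with hβ
  have hω : oddRoot N k =
      Complex.exp ((β : ℂ) * Complex.I) * Complex.exp ((β : ℂ) * Complex.I) := by
    rw [← Complex.exp_add, oddRoot, hβ]
    congr 1
    push_cast
    have hN' : (N : ℂ) ≠ 0 := by exact_mod_cast hN
    field_simp
    ring
  set ω := oddRoot N k with hωdef
  have hgeom : signEigenvalue N k * (1 - ω) = 1 + ω := by
    have h1 : signEigenvalue N k = ω * ∑ l ∈ Finset.range (N - 1), ω ^ l := by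
      rw [signEigenvalue, Finset.mul_sum]
      refine Finset.sum_congr rfl fun l _ => ?_
      rw [zpow_add_one₀ (oddRoot_ne_zero _ _), zpow_natCast, mul_comm]
    have h2 := mul_neg_geom_sum ω (N - 1)
    have h3 : ω * ω ^ (N - 1) = -1 := by
      rw [← pow_succ', Nat.sub_add_cancel (by omega), oddRoot_pow_self hN]
    rw [h1]
    linear_combination ω * h2 - h3
  set z := Complex.exp ((β : ℂ) * Complex.I) with hz
  set z' := Complex.exp (-(β : ℂ) * Complex.I) with hz'
  have hzz : z * z' = 1 := by
    rw [hz, hz', ← Complex.exp_add]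
    simp
  have hcos : 1 + ω = z * (2 * Complex.cos β) := by
    rw [Complex.two_cos, ← hz, ← hz', hω]
    linear_combination -hzz
  have hsin : (1 - ω) = z * (-Complex.I * (2 * Complex.sin β)) := by
    rw [Complex.two_sin, ← hz, ← hz', hω]
    linear_combination (z * z' - z * z) * Complex.I_sq - hzz
  have hβ0 : 0 < β := by positivity
  have hβπ : β < Real.pi := by
    rw [hβ, div_lt_iff₀ (by positivity)]
    have : (2 * (k : ℝ) + 1) < 2 * N := by exact_mod_cast (by omega : 2 * k + 1 < 2 * N)
    nlinarith [Real.pi_pos]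
  have hs : 0 < Real.sin β := Real.sin_pos_of_pos_of_lt_pi hβ0 hβπ
  have hnz : ‖z‖ = 1 := Complex.norm_exp_ofReal_mul_I _
  have h4 := congrArg norm hgeom
  rw [norm_mul, hcos, hsin, norm_mul, norm_mul, norm_mul, norm_mul, norm_mul, hnz,
    ← Complex.ofReal_cos, ← Complex.ofReal_sin, Complex.norm_real, Complex.norm_real, norm_neg,
    Complex.norm_I] at h4
  simp only [Real.norm_eq_abs, Complex.norm_ofNat, one_mul] at h4
  rw [Real.cot_eq_cos_div_sin, abs_div, eq_div_iff (abs_pos.2 hs.ne').ne']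
  linarith

/-- The sign matrix is a skew-circulant matrix, so that its eigenvectors are the vectors of powers
of the `N`-th roots of `-1`. -/
theorem signMatrix_apply_eq {N : ℕ} (i j : Fin N) :
    signMatrix N i j = ∑ k ∈ Finset.range N,
      signEigenvalue N k / N * oddRoot N k ^ (i : ℤ) * oddRoot N k ^ (-(j : ℤ)) := by
  have hi := i.2
  have hj := j.2
  have hN : N ≠ 0 := by omega
  have hN' : (N : ℂ) ≠ 0 := by exact_mod_cast hN
  have h1 : ∑ k ∈ Finset.range N,
      signEigenvalue N k / N * oddRoot N k ^ (i : ℤ) * oddRoot N k ^ (-(j : ℤ)) =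
      (N : ℂ)⁻¹ * ∑ l ∈ Finset.range (N - 1), ∑ k ∈ Finset.range N,
        oddRoot N k ^ ((l : ℤ) + 1 + i - j) := by
    rw [Finset.sum_comm, Finset.mul_sum]
    refine Finset.sum_congr rfl fun k _ => ?_
    simp only [sub_eq_add_neg, zpow_add₀ (oddRoot_ne_zero N k), ← Finset.sum_mul]
    rw [signEigenvalue]
    simp only [zpow_add₀ (oddRoot_ne_zero N k), ← Finset.sum_mul]
    ring
  rw [h1, signMatrix, of_apply]
  split_ifs with hij hji
  · have hij' : (i : ℕ) < j := hij
    rw [Finset.sum_eq_single (j - i - 1 : ℕ)]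
    · have : ((j - i - 1 : ℕ) : ℤ) + 1 + i - j = 0 := by omega
      simp [this, hN']
    · intro l hl hne
      rw [Finset.mem_range] at hl
      exact sum_oddRoot_zpow hN (not_dvd_of_lt (by omega) (by omega) (by omega))
    · intro h
      rw [Finset.mem_range] at h
      omega
  · have hji' : (j : ℕ) < i := hji
    rw [Finset.sum_eq_single (N - (i - j) - 1 : ℕ)]
    · have : ((N - (i - j) - 1 : ℕ) : ℤ) + 1 + i - j = N := by omega
      simp [this, oddRoot_pow_self hN, hN']
    · intro l hl hne
      rw [Finset.mem_range] at hl
      refine sum_oddRoot_zpow hN fun h => ?_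
      have h2 := h.sub (dvd_refl (N : ℤ))
      exact not_dvd_of_lt (by omega) (by omega) (by omega) h2
    · intro h
      rw [Finset.mem_range] at h
      omega
  · have hij' : i = j := le_antisymm (not_lt.1 hji) (not_lt.1 hij)
    subst hij'
    rw [Finset.sum_eq_zero, mul_zero]
    intro l hl
    rw [Finset.mem_range] at hl
    exact sum_oddRoot_zpow hN (not_dvd_of_lt (by omega) (by omega) (by omega))

theorem SchurBound.signMatrix (q : ℕ) : SchurBound (delta (q + 1)) (signMatrix (2 ^ q)) := by
  have h := SchurBound.sum (Finset.range (2 ^ q)) fun k _ =>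
    SchurBound.rankOne (A := Fin (2 ^ q)) (signEigenvalue (2 ^ q) k / (2 ^ q : ℕ))
      (u := fun j => oddRoot (2 ^ q) k ^ (j : ℤ))
      (w := fun j => oddRoot (2 ^ q) k ^ (-(j : ℤ)))
      (fun a => by rw [norm_zpow, norm_oddRoot, _root_.one_zpow])
      (fun a => by rw [norm_zpow, norm_oddRoot, _root_.one_zpow])
  convert h using 1
  · rw [delta, Nat.add_sub_cancel, ← Finset.Ico_add_one_right_eq_Icc,
      Finset.sum_Ico_eq_sum_range, Nat.add_sub_cancel, Finset.mul_sum]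
    refine Finset.sum_congr rfl fun k hk => ?_
    rw [norm_div, norm_signEigenvalue (Finset.mem_range.1 hk), Complex.norm_natCast]
    push_cast
    rw [div_mul_eq_mul_div, one_mul]
    congr 4
    · ring
    · ring
  · ext i j
    rw [signMatrix_apply_eq, Matrix.sum_apply]
    rfl

/-- `1` for even `j`, and `-1` for odd `j`. -/
def paritySign {N : ℕ} (j : Fin N) : ℂ := (-1) ^ (j : ℕ)

theorem norm_paritySign {N : ℕ} (j : Fin N) : ‖paritySign j‖ ≤ 1 := by
  simp [paritySign]

theorem exp_half (θ : ℝ) : Complex.exp (Complex.I / 2 * θ) =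
    Real.cos (θ / 2) + Real.sin (θ / 2) * Complex.I := by
  have : Complex.I / 2 * θ = ((θ / 2 : ℝ) : ℂ) * Complex.I := by
    push_cast
    ring
  rw [this, Complex.exp_mul_I, Complex.ofReal_cos, Complex.ofReal_sin]

theorem star_exp_half (θ : ℝ) : star (Complex.exp (Complex.I / 2 * θ)) =
    Real.cos (θ / 2) - Real.sin (θ / 2) * Complex.I := by
  rw [exp_half, ← starRingEnd_apply, map_add, map_mul, Complex.conj_ofReal, Complex.conj_ofReal,
    Complex.conj_I]
  ring

theorem paritySign_eq {N : ℕ} (j : Fin N) : paritySign j = if j.val % 2 = 0 then 1 else -1 := by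
  rw [paritySign]
  split_ifs with h
  · exact (Nat.even_iff.2 h).neg_one_pow
  · exact (Nat.odd_iff.2 (Nat.mod_two_ne_zero.1 h)).neg_one_pow

theorem nat_order_cases (a b : ℕ) : (a < b ∧ ¬ b < a ∧ a ≠ b) ∨ (¬ a < b ∧ ¬ b < a ∧ a = b) ∨
    (¬ a < b ∧ b < a ∧ a ≠ b) := by
  omega

theorem deformation_apply (p : ℕ) (θ : ℝ) (j k : Fin (2 ^ p)) :
    deformation p θ j k =
      if j.val / 2 = k.val / 2 ∨ j.val % 2 ≠ k.val % 2 then 1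
      else if j.val / 2 < k.val / 2 ↔ j.val % 2 = 0 then Complex.exp (Complex.I / 2 * θ)
      else star (Complex.exp (Complex.I / 2 * θ)) := by
  rw [deformation, of_apply]
  generalize Complex.exp (Complex.I / 2 * θ) = γ
  have hj : j.val % 2 = (Fin.ofNat 2 j.val).val := rfl
  have hk : k.val % 2 = (Fin.ofNat 2 k.val).val := rfl
  rw [hj, hk]
  generalize Fin.ofNat 2 j.val = a
  generalize Fin.ofNat 2 k.val = b
  rcases nat_order_cases (j.val / 2) (k.val / 2) with ⟨h1, h2, h3⟩ | ⟨h1, h2, h3⟩ | ⟨h1, h2, h3⟩ <;>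
  fin_cases a <;> fin_cases b <;> simp [deformationBlock, h1, h2, h3]

/-- The deviation of `D(θ)` from the all-ones matrix is
`(cos (θ/2) - 1) (J ⊗ 1 - 1 ⊗ 1) + i sin (θ/2) (S ⊗ diag(1, -1))`, where `J` is the all-ones matrix
and `S` is the sign matrix. -/
theorem schurBound_deformation (q : ℕ) (θ : ℝ) (hθ : 0 ≤ Real.sin (θ / 2)) :
    SchurBound (2 * (1 - Real.cos (θ / 2)) + delta (q + 1) * Real.sin (θ / 2))
      (Matrix.of fun i j => deformation (q + 1) θ i j - 1) := by
  let f : Fin (2 ^ (q + 1)) → Fin (2 ^ q) := fun j => ⟨j / 2, by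
    have := j.2
    have h2 : 2 ^ (q + 1) = 2 ^ q * 2 := pow_succ 2 q
    omega⟩
  have hone : ∀ a : Fin (2 ^ (q + 1)), ‖(1 : ℂ)‖ ≤ 1 := fun _ => by simp
  have hpinch := (SchurBound.rankOne (1 / 2) hone hone).add
    (SchurBound.rankOne (1 / 2) (norm_paritySign (N := 2 ^ (q + 1))) norm_paritySign)
  have htau := (SchurBound.rankOne (1 / 2) (norm_paritySign (N := 2 ^ (q + 1))) hone).add
    (SchurBound.rankOne (1 / 2) hone norm_paritySign)
  have hsgn := ((SchurBound.signMatrix q).submatrix f).hadamard htau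
  have h := ((hpinch.add ((SchurBound.one (2 ^ (q + 1))).smul (-1))).smul
    ((Real.cos (θ / 2) - 1 : ℝ) : ℂ)).add (hsgn.smul (Real.sin (θ / 2) * Complex.I))
  convert h using 1
  · rw [norm_mul, Complex.norm_real, Complex.norm_real, Complex.norm_I, Real.norm_eq_abs,
      Real.norm_eq_abs, abs_of_nonneg hθ, abs_of_nonpos (by linarith [Real.cos_le_one (θ / 2)])]
    norm_num
    ring
  · ext i j
    have hlt : ∀ a b : Fin (2 ^ (q + 1)), f a < f b ↔ a.val / 2 < b.val / 2 := fun a b => Iff.rfl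
    have hij : i = j ↔ i.val / 2 = j.val / 2 ∧ i.val % 2 = j.val % 2 := by
      rw [Fin.ext_iff]
      omega
    simp only [of_apply, deformation_apply, Matrix.add_apply, Matrix.smul_apply, hadamard_apply,
      submatrix_apply, QZE.signMatrix, hlt, smul_eq_mul, one_apply, hij, paritySign_eq,
      star_exp_half]
    simp only [exp_half]
    rcases Nat.mod_two_eq_zero_or_one i.val with hi | hi <;>
    rcases Nat.mod_two_eq_zero_or_one j.val with hj | hj <;>
    rcases nat_order_cases (i.val / 2) (j.val / 2) with
      ⟨h1, h2, h3⟩ | ⟨h1, h2, h3⟩ | ⟨h1, h2, h3⟩ <;>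
    simp only [hi, hj, h1, h2, h3, lt_self_iff_false, if_true, if_false, zero_ne_one, one_ne_zero,
      and_true, and_false, or_true, or_false, ne_eq, iff_true, iff_false, not_true,
      not_false_iff] <;>
    push_cast <;> ring

/-! ### The structure of `𝔏^p_0` and `𝔏^p_θ` -/

theorem blockEquiv_inl_val {p : ℕ} (a : Fin (2 ^ p)) : (blockEquiv p (Sum.inl a)).val = a.val := by
  simp [blockEquiv]

theorem blockEquiv_inr_val {p : ℕ} (a : Fin (2 ^ p)) :
    (blockEquiv p (Sum.inr a)).val = 2 ^ p + a.val := by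
  simp [blockEquiv, add_comm]

theorem smul_mem_undeformed {p : ℕ} (c : ℂ) {M : Matrix (Fin (2 ^ p)) (Fin (2 ^ p)) ℂ}
    (hM : M ∈ undeformed p) : c • M ∈ undeformed p := by
  induction p with
  | zero => trivial
  | succ p ih =>
    obtain ⟨A, hA, B, hB, rfl⟩ := hM
    refine ⟨c • A, ih hA, c • B, ih hB, ?_⟩
    rw [← fromBlocks_smul]
    rfl

/-- The algebra `𝔏^p_0` is simultaneously diagonalized by a unitary matrix, and it contains the
projections onto the eigenvectors. -/
theorem exists_isParseval_undeformed (p : ℕ) :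
    ∃ (κ : Type) (_ : Fintype κ) (h : κ → Fin (2 ^ p) → ℂ), IsParseval h ∧
      ∀ k, (Matrix.of fun i j => h k i * star (h k j)) ∈ undeformed p := by
  induction p with
  | zero =>
    refine ⟨Unit, inferInstance, fun _ _ => 1, fun i j => ?_, fun _ => trivial⟩
    have : i = j := Subsingleton.elim (α := Fin 1) i j
    simp [this]
  | succ p ih =>
    obtain ⟨κ, _, h, hh, hmem⟩ := ih
    -- the eigenvectors of `[[A, B], [B, A]]` are `(v, ± v) / √2` for the common eigenvectors `v`
    obtain ⟨r, hr⟩ : ∃ r : ℂ, r * star r = 1 / 2 := by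
      refine ⟨((Real.sqrt 2)⁻¹ : ℝ), ?_⟩
      rw [← starRingEnd_apply, Complex.conj_ofReal, ← Complex.ofReal_mul, ← mul_inv,
        Real.mul_self_sqrt (by norm_num)]
      norm_num
    let g : κ ⊕ κ → Fin (2 ^ p) ⊕ Fin (2 ^ p) → ℂ := Sum.elim
      (fun k => Sum.elim (fun i => r * h k i) fun i => r * h k i)
      (fun k => Sum.elim (fun i => r * h k i) fun i => -(r * h k i))
    have hmul : ∀ k i j, r * h k i * star (r * h k j) = 1 / 2 * (h k i * star (h k j)) := by
      intro k i j
      rw [← hr, star_mul']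
      ring
    refine ⟨κ ⊕ κ, inferInstance, fun k i => g k ((blockEquiv p).symm i), ?_, ?_⟩
    · intro i j
      obtain ⟨i, rfl⟩ := (blockEquiv p).surjective i
      obtain ⟨j, rfl⟩ := (blockEquiv p).surjective j
      simp only [Equiv.symm_apply_apply, EmbeddingLike.apply_eq_iff_eq, Fintype.sum_sum_type]
      rcases i with i | i <;> rcases j with j | j <;>
      simp only [g, Sum.elim_inl, Sum.elim_inr, star_neg, mul_neg, neg_mul, neg_neg, hmul,
        Finset.sum_neg_distrib, ← Finset.mul_sum, hh i j, Sum.inl.injEq, Sum.inr.injEq,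
        reduceCtorEq, if_false] <;>
      ring
    · rintro (k | k)
      · refine ⟨_, smul_mem_undeformed (1 / 2) (hmem k), _,
          smul_mem_undeformed (1 / 2) (hmem k), ?_⟩
        ext i j
        obtain ⟨i, rfl⟩ := (blockEquiv p).surjective i
        obtain ⟨j, rfl⟩ := (blockEquiv p).surjective j
        rcases i with i | i <;> rcases j with j | j <;>
        simp only [g, of_apply, Equiv.symm_apply_apply, Sum.elim_inl, Sum.elim_inr, reindex_apply,
          submatrix_apply, fromBlocks_apply₁₁, fromBlocks_apply₁₂, fromBlocks_apply₂₁,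
          fromBlocks_apply₂₂, Matrix.smul_apply, smul_eq_mul, hmul]
      · refine ⟨_, smul_mem_undeformed (1 / 2) (hmem k), _,
          smul_mem_undeformed (-(1 / 2)) (hmem k), ?_⟩
        ext i j
        obtain ⟨i, rfl⟩ := (blockEquiv p).surjective i
        obtain ⟨j, rfl⟩ := (blockEquiv p).surjective j
        rcases i with i | i <;> rcases j with j | j <;>
        simp only [g, of_apply, Equiv.symm_apply_apply, Sum.elim_inl, Sum.elim_inr, reindex_apply,
          submatrix_apply, fromBlocks_apply₁₁, fromBlocks_apply₁₂, fromBlocks_apply₂₁,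
          fromBlocks_apply₂₂, Matrix.smul_apply, smul_eq_mul, star_neg, mul_neg, neg_mul, neg_neg,
          hmul]

theorem two_pow_add_xor {p a b : ℕ} (ha : a < 2 ^ p) (hb : b < 2 ^ p) :
    (2 ^ p + a) ^^^ b = 2 ^ p + (a ^^^ b) := by
  have h : ∀ c < 2 ^ p, 2 ^ p + c = 2 ^ p ^^^ c := by
    intro c hc
    refine Nat.eq_of_testBit_eq fun i => ?_
    rw [Nat.testBit_xor, Nat.testBit_two_pow]
    rcases lt_trichotomy i p with h1 | rfl | h1
    · rw [Nat.testBit_two_pow_add_gt h1]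
      simp [h1.ne']
    · rw [Nat.testBit_two_pow_add_eq]
      simp
    · have h2 : 2 ^ (p + 1) ≤ 2 ^ i := Nat.pow_le_pow_right (by norm_num) h1
      have h3 : 2 ^ (p + 1) = 2 ^ p * 2 := pow_succ 2 p
      rw [Nat.testBit_lt_two_pow (by omega : 2 ^ p + c < 2 ^ i),
        Nat.testBit_lt_two_pow (by omega : c < 2 ^ i)]
      simp [h1.ne]
  rw [h a ha, h _ (Nat.xor_lt_two_pow ha hb), Nat.xor_assoc]

/-- The entries of a matrix in `𝔏^p_0` depend only on the bitwise sum of the two indices. -/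
theorem exists_xor_of_mem_undeformed {p : ℕ} {M : Matrix (Fin (2 ^ p)) (Fin (2 ^ p)) ℂ}
    (hM : M ∈ undeformed p) : ∃ f : ℕ → ℂ, ∀ i j, M i j = f (i.val ^^^ j.val) := by
  induction p with
  | zero =>
    refine ⟨fun _ => M 0 0, fun i j => ?_⟩
    rw [Subsingleton.elim (α := Fin 1) i 0, Subsingleton.elim (α := Fin 1) j 0]
  | succ p ih =>
    obtain ⟨A, hA, B, hB, rfl⟩ := hM
    obtain ⟨f, hf⟩ := ih hA
    obtain ⟨g, hg⟩ := ih hB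
    refine ⟨fun t => if t < 2 ^ p then f t else g (t - 2 ^ p), fun i j => ?_⟩
    obtain ⟨i, rfl⟩ := (blockEquiv p).surjective i
    obtain ⟨j, rfl⟩ := (blockEquiv p).surjective j
    rw [reindex_apply, submatrix_apply, Equiv.symm_apply_apply, Equiv.symm_apply_apply]
    rcases i with i | i <;> rcases j with j | j <;>
    simp only [blockEquiv_inl_val, blockEquiv_inr_val, fromBlocks_apply₁₁, fromBlocks_apply₁₂,
      fromBlocks_apply₂₁, fromBlocks_apply₂₂, hf, hg]
    · rw [if_pos (Nat.xor_lt_two_pow i.2 j.2)]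
    · rw [Nat.xor_comm i.val (2 ^ p + j.val), two_pow_add_xor j.2 i.2, if_neg (by omega),
        Nat.add_sub_cancel_left,
        Nat.xor_comm i.val]
    · rw [two_pow_add_xor i.2 j.2, if_neg (by omega), Nat.add_sub_cancel_left]
    · have : (2 ^ p + i.val) ^^^ (2 ^ p + j.val) = i.val ^^^ j.val := by
        have h1 := two_pow_add_xor i.2 j.2
        have h2 := two_pow_add_xor (p := p) (a := 0) (b := j.val) (by positivity) j.2
        have h3 := two_pow_add_xor (p := p) (a := 0) (b := i.val) (by positivity) i.2
        simp only [add_zero, Nat.zero_xor] at h2 h3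
        rw [← h2, ← h3, Nat.xor_comm (2 ^ p) i.val, Nat.xor_assoc, ← Nat.xor_assoc (2 ^ p),
          Nat.xor_self, Nat.zero_xor]
      rw [this, if_pos (Nat.xor_lt_two_pow i.2 j.2)]

theorem rev_xor_rev {p : ℕ} (i j : Fin (2 ^ p)) : i.rev.val ^^^ j.rev.val = i.val ^^^ j.val := by
  refine Nat.eq_of_testBit_eq fun t => ?_
  have h : ∀ i : Fin (2 ^ p), i.rev.val = 2 ^ p - (i.val + 1) := fun i => by
    rw [Fin.val_rev]
  rw [Nat.testBit_xor, Nat.testBit_xor, h, h, Nat.testBit_two_pow_sub_succ i.2,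
    Nat.testBit_two_pow_sub_succ j.2]
  by_cases ht : t < p
  · simp [ht]
  · have h2 : 2 ^ p ≤ 2 ^ t := Nat.pow_le_pow_right (by norm_num) (not_lt.1 ht)
    rw [Nat.testBit_lt_two_pow (i.2.trans_le h2), Nat.testBit_lt_two_pow (j.2.trans_le h2)]
    simp [ht]

theorem deformation_rev {q : ℕ} (θ : ℝ) (i j : Fin (2 ^ (q + 1))) :
    deformation (q + 1) θ i.rev j.rev = deformation (q + 1) θ i j := by
  have h : 2 ^ (q + 1) = 2 ^ q * 2 := pow_succ 2 q
  have hi := i.2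
  have hj := j.2
  rw [deformation_apply, deformation_apply, Fin.val_rev, Fin.val_rev]
  split_ifs <;> first | rfl | (exfalso; omega)

/-- The index `2 k + b`. -/
def bitIndex {q : ℕ} (k : Fin (2 ^ q)) (b : Fin 2) : Fin (2 ^ (q + 1)) :=
  ⟨2 * k + b, by
    have h2 : 2 ^ (q + 1) = 2 ^ q * 2 := pow_succ 2 q
    omega⟩

/-- The block structure of a matrix in `𝔏^p_θ`. Reversal of the indices maps each block to the
opposite one and exchanges the rows and the columns within it, so that it preserves the entries. -/
theorem exists_blocks_of_mem_deformed {q : ℕ} {θ : ℝ}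
    {M : Matrix (Fin (2 ^ (q + 1))) (Fin (2 ^ (q + 1))) ℂ} (hM : M ∈ deformed (q + 1) θ) :
    ∃ f g : Fin (2 ^ q) → Fin (2 ^ q) → ℂ,
      (∀ i j, M i.rev j.rev = M i j) ∧ (∀ k l, f k k = f l l) ∧
      (∀ k, M (bitIndex k 0) (bitIndex k 0) = f k k ∧ M (bitIndex k 1) (bitIndex k 1) = f k k) ∧
      (∀ k l, M (bitIndex k 0) (bitIndex l 1) = g k l ∧
        M (bitIndex k 1) (bitIndex l 0) = g k l) ∧
      (∀ k l, k < l → M (bitIndex k 0) (bitIndex l 0) =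
          Complex.exp (Complex.I / 2 * θ) * f k l ∧
        M (bitIndex k 1) (bitIndex l 1) = star (Complex.exp (Complex.I / 2 * θ)) * f k l) ∧
      (∀ k l, l < k → M (bitIndex k 0) (bitIndex l 0) =
          star (Complex.exp (Complex.I / 2 * θ)) * f k l ∧
        M (bitIndex k 1) (bitIndex l 1) = Complex.exp (Complex.I / 2 * θ) * f k l) := by
  obtain ⟨N, hN, rfl⟩ := hM
  obtain ⟨f, hf⟩ := exists_xor_of_mem_undeformed hN
  have hx : ∀ k l : ℕ, (2 * k + 1) ^^^ (2 * l + 1) = (2 * k) ^^^ (2 * l) := by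
    intro k l
    refine Nat.eq_of_testBit_eq fun t => ?_
    rw [Nat.testBit_xor, Nat.testBit_xor]
    cases t <;> simp [Nat.testBit_succ, Nat.mul_add_div]
  have hx' : ∀ k l : ℕ, (2 * k + 1) ^^^ (2 * l) = (2 * k) ^^^ (2 * l + 1) := by
    intro k l
    refine Nat.eq_of_testBit_eq fun t => ?_
    rw [Nat.testBit_xor, Nat.testBit_xor]
    cases t <;> simp [Nat.testBit_succ, Nat.mul_add_div]
  have hd0 : ∀ k : ℕ, 2 * k / 2 = k := fun k => by omega
  have hd1 : ∀ k : ℕ, (2 * k + 1) / 2 = k := fun k => by omega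
  have hm0 : ∀ k : ℕ, 2 * k % 2 = 0 := fun k => by omega
  have hm1 : ∀ k : ℕ, (2 * k + 1) % 2 = 1 := fun k => by omega
  refine ⟨fun k l => f ((2 * k) ^^^ (2 * l)), fun k l => f ((2 * k) ^^^ (2 * l + 1)),
    fun i j => ?_, fun k l => by simp, fun k => ?_, fun k l => ?_, fun k l h => ?_, fun k l h => ?_⟩
  · change deformation (q + 1) θ i.rev j.rev * N i.rev j.rev = deformation (q + 1) θ i j * N i j
    rw [hf, hf, rev_xor_rev, deformation_rev]
  · simp [hadamard_apply, hf, deformation_apply, bitIndex]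
  · simp [hadamard_apply, hf, deformation_apply, bitIndex, hx']
  · have h1 : k.val < l.val := h
    simp [hadamard_apply, hf, deformation_apply, bitIndex, hx, hd0, hd1, hm0, hm1, h1, h1.ne]
  · have h1 : l.val < k.val := h
    simp [hadamard_apply, hf, deformation_apply, bitIndex, hx, hd0, hd1, hm0, hm1, h1.not_gt,
      h1.ne']

/-! ### The codes -/

/-- The basis index `(j, …, j)` with `j = 2 k + b`, where `j` is reversed at the places in `x`. -/
def codeString {m q : ℕ} (x : Fin m → Bool) (k : Fin (2 ^ q)) (b : Fin 2) :
    Fin m → Fin (2 ^ (q + 1)) :=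
  fun i => if x i then (bitIndex k b).rev else bitIndex k b

/-- The isometry whose columns `(|2k, …, 2k⟩ + i |2k+1, …, 2k+1⟩) / √2`, with the indices reversed
at the places in `x`, are the basis of a code. -/
def codeMatrix {m : ℕ} (q : ℕ) (x : Fin m → Bool) :
    Matrix (Fin m → Fin (2 ^ (q + 1))) (Fin (2 ^ q)) ℂ :=
  Matrix.of fun a k => (((Real.sqrt 2)⁻¹ : ℝ) : ℂ) *
    ((if a = codeString x k 0 then 1 else 0) + Complex.I * if a = codeString x k 1 then 1 else 0)

theorem codeMatrix_conjTranspose_mul_mul_apply {m q : ℕ} (x y : Fin m → Bool)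
    (T : Matrix (Fin m → Fin (2 ^ (q + 1))) (Fin m → Fin (2 ^ (q + 1))) ℂ) (k l : Fin (2 ^ q)) :
    ((codeMatrix q x)ᴴ * T * codeMatrix q y) k l =
      1 / 2 * (T (codeString x k 0) (codeString y l 0) + T (codeString x k 1) (codeString y l 1) +
        Complex.I * T (codeString x k 0) (codeString y l 1) -
        Complex.I * T (codeString x k 1) (codeString y l 0)) := by
  set r : ℂ := (((Real.sqrt 2)⁻¹ : ℝ) : ℂ) with hr
  have hrr : r * r = 1 / 2 := by
    rw [hr, ← Complex.ofReal_mul, ← mul_inv, Real.mul_self_sqrt (by norm_num)]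
    norm_num
  have hstar : ∀ (a : Fin m → Fin (2 ^ (q + 1))), star (codeMatrix q x a k) =
      r * ((if a = codeString x k 0 then 1 else 0) -
        Complex.I * if a = codeString x k 1 then 1 else 0) := by
    intro a
    rw [codeMatrix, of_apply, ← starRingEnd_apply, map_mul, Complex.conj_ofReal, map_add, map_mul,
      Complex.conj_I, apply_ite (starRingEnd ℂ), apply_ite (starRingEnd ℂ), map_one, map_zero,
      neg_mul, ← sub_eq_add_neg]
  have h1 : ∀ b, ((codeMatrix q x)ᴴ * T) k b =
      r * (T (codeString x k 0) b - Complex.I * T (codeString x k 1) b) := by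
    intro b
    simp only [mul_apply, conjTranspose_apply, hstar, mul_sub, sub_mul, mul_ite, ite_mul, mul_one,
      mul_zero, zero_mul, Finset.sum_sub_distrib, Finset.sum_ite_eq', Finset.mem_univ, if_true]
    ring
  rw [mul_apply]
  simp only [h1]
  simp only [codeMatrix, of_apply, mul_add, mul_ite, mul_one, mul_zero,
    Finset.sum_add_distrib, Finset.sum_ite_eq', Finset.mem_univ, if_true, ← hr]
  rw [← hrr]
  linear_combination (-(r * r * T (codeString x k 1) (codeString y l 1))) * Complex.I_sq

theorem codeMatrix_conjTranspose_mul_apply {m q : ℕ} (x y : Fin m → Bool) (k l : Fin (2 ^ q)) :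
    ((codeMatrix q x)ᴴ * codeMatrix q y) k l =
      1 / 2 * ((if codeString x k 0 = codeString y l 0 then 1 else 0) +
        (if codeString x k 1 = codeString y l 1 then 1 else 0) +
        Complex.I * (if codeString x k 0 = codeString y l 1 then 1 else 0) -
        Complex.I * (if codeString x k 1 = codeString y l 0 then 1 else 0)) := by
  have := codeMatrix_conjTranspose_mul_mul_apply x y 1 k l
  rwa [Matrix.mul_one] at this

theorem codeString_eq_swap_iff {m q : ℕ} (x y : Fin m → Bool) (k l : Fin (2 ^ q)) :
    codeString x k 0 = codeString y l 1 ↔ codeString x k 1 = codeString y l 0 := by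
  have h : 2 ^ (q + 1) = 2 ^ q * 2 := pow_succ 2 q
  simp only [funext_iff]
  refine forall_congr' fun i => ?_
  have hk := k.2
  have hl := l.2
  cases hx : x i <;> cases hy : y i <;>
  simp only [codeString, hx, hy, if_true, if_false, Bool.false_eq_true, bitIndex, Fin.ext_iff,
    Fin.val_rev, Fin.val_zero, Fin.val_one] <;>
  omega

theorem codeMatrix_conjTranspose_mul_self {m q : ℕ} (hm : 1 ≤ m) (x : Fin m → Bool) :
    (codeMatrix q x)ᴴ * codeMatrix q x = 1 := by
  have key : ∀ (k l : Fin (2 ^ q)) (b c : Fin 2),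
      codeString x k b = codeString x l c → k = l ∧ b = c := by
    intro k l b c hkl
    have h1 : bitIndex k b = bitIndex l c := by
      have := congrFun hkl ⟨0, hm⟩
      cases hx : x ⟨0, hm⟩ <;> simpa [codeString, hx] using this
    have h2 : 2 * k.val + b.val = 2 * l.val + c.val := congrArg Fin.val h1
    exact ⟨Fin.ext (by omega), Fin.ext (by omega)⟩
  ext k l
  have h01 : codeString x k 0 ≠ codeString x l 1 := fun h => absurd (key _ _ _ _ h).2 (by simp)
  have h10 : codeString x k 1 ≠ codeString x l 0 := fun h => absurd (key _ _ _ _ h).2 (by simp)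
  rw [codeMatrix_conjTranspose_mul_apply, if_neg h01, if_neg h10]
  rcases eq_or_ne k l with rfl | hkl
  · simp
    norm_num
  · rw [if_neg fun h => hkl (key _ _ _ _ h).1, if_neg fun h => hkl (key _ _ _ _ h).1,
      one_apply_ne hkl]
    simp

/-- The codes for different `x` are orthogonal. For complementary `x` and `y` the basis vectors
have the same support, but then the two contributions to the inner product cancel. -/
theorem codeMatrix_conjTranspose_mul_of_ne {m q : ℕ} {x y : Fin m → Bool} (hxy : x ≠ y) :
    (codeMatrix q x)ᴴ * codeMatrix q y = 0 := by
  obtain ⟨i, hi⟩ := Function.ne_iff.1 hxy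
  have h : 2 ^ (q + 1) = 2 ^ q * 2 := pow_succ 2 q
  have key : ∀ (k l : Fin (2 ^ q)) (b : Fin 2), codeString x k b ≠ codeString y l b := by
    intro k l b hkl
    have h1 := congrFun hkl i
    have hk := k.2
    have hl := l.2
    cases hx : x i <;> cases hy : y i <;>
    simp only [codeString, hx, hy, if_true, if_false, Bool.false_eq_true, bitIndex, Fin.ext_iff,
      Fin.val_rev] at h1 <;>
    first | omega | (rw [hx, hy] at hi; exact hi rfl)
  ext k l
  rw [codeMatrix_conjTranspose_mul_apply, if_neg (key k l 0), if_neg (key k l 1)]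
  simp only [codeString_eq_swap_iff]
  simp

theorem exp_half_pi_div_pow {m : ℕ} (hm : 1 ≤ m) :
    Complex.exp (Complex.I / 2 * (Real.pi / m : ℝ)) ^ m = Complex.I := by
  have hm0 : (m : ℂ) ≠ 0 := by exact_mod_cast (by omega : m ≠ 0)
  rw [← Complex.exp_nat_mul]
  have : (m : ℂ) * (Complex.I / 2 * (Real.pi / m : ℝ)) = Real.pi / 2 * Complex.I := by
    push_cast
    field_simp
  rw [this, Complex.exp_pi_div_two_mul_I]

/-- The Knill–Laflamme conditions for the codes. Off the diagonal, the two diagonal entries of the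
blocks contribute the phases `γ^m = i` and `conj γ^m = -i`, which cancel. -/
theorem exists_codeMatrix_compression_eq_smul {m q : ℕ} (hm : 1 ≤ m) (x : Fin m → Bool)
    {M : Fin m → Matrix (Fin (2 ^ (q + 1))) (Fin (2 ^ (q + 1))) ℂ}
    (hM : ∀ i, M i ∈ deformed (q + 1) (Real.pi / m)) :
    ∃ c : ℂ, (codeMatrix q x)ᴴ * tensorMatrix M * codeMatrix q x = c • 1 := by
  choose f g hrev hconst hdiag hoff hlt hgt using fun i => exists_blocks_of_mem_deformed (hM i)
  have hT : ∀ (k l : Fin (2 ^ q)) (b c : Fin 2),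
      tensorMatrix M (codeString x k b) (codeString x l c) =
        ∏ i, M i (bitIndex k b) (bitIndex l c) := by
    intro k l b c
    rw [tensorMatrix, of_apply]
    refine Finset.prod_congr rfl fun i _ => ?_
    cases hx : x i <;> simp [codeString, hx, hrev]
  have hγ := exp_half_pi_div_pow hm
  have hγ' : star (Complex.exp (Complex.I / 2 * (Real.pi / m : ℝ))) ^ m = -Complex.I := by
    rw [← star_pow, hγ, ← starRingEnd_apply, Complex.conj_I]
  refine ⟨∏ i, f i 0 0, ?_⟩
  ext k l
  rw [codeMatrix_conjTranspose_mul_mul_apply, hT, hT, hT, hT]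
  simp only [(hoff _ _ _).1, (hoff _ _ _).2]
  rcases lt_trichotomy k l with h | rfl | h
  · simp only [(hlt _ _ _ h).1, (hlt _ _ _ h).2, Finset.prod_mul_distrib, Finset.prod_const,
      Finset.card_univ, Fintype.card_fin, hγ, hγ', Matrix.smul_apply, one_apply_ne h.ne, smul_zero]
    ring
  · simp only [(hdiag _ _).1, (hdiag _ _).2, hconst _ k 0, Matrix.smul_apply, one_apply_eq,
      smul_eq_mul]
    ring
  · simp only [(hgt _ _ _ h).1, (hgt _ _ _ h).2, Finset.prod_mul_distrib, Finset.prod_const,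
      Finset.card_univ, Fintype.card_fin, hγ, hγ', Matrix.smul_apply, one_apply_ne h.ne',
      smul_zero]
    ring

theorem isErrorCorrectingCode_range_codeMatrix {m q : ℕ} (hm : 1 ≤ m) {B : Type*} [Fintype B]
    {Φ : Matrix (Fin (2 ^ (q + 1))) (Fin (2 ^ (q + 1))) ℂ →ₗ[ℂ] Matrix B B ℂ}
    (hgraph : HasNoncommutativeGraph Φ (deformed (q + 1) (Real.pi / m))) (x : Fin m → Bool) :
    IsErrorCorrectingCode (tensorPower m Φ)
      (LinearMap.range (toEuclideanLin (codeMatrix q x))) := by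
  obtain ⟨d, K, hK, hK1, hKL, -⟩ := hgraph.exists_hasKraus
  have htK := hK.tensorPower m
  have htK1 : ∑ e : Fin m → Fin d, (tensorMatrix fun i => K (e i))ᴴ *
      (tensorMatrix fun i => K (e i)) = 1 := by
    simp only [tensorMatrix_conjTranspose, tensorMatrix_mul]
    rw [← tensorMatrix_sum fun _ e => (K e)ᴴ * K e]
    simp only [hK1, tensorMatrix_one]
  classical
  refine isErrorCorrectingCode_range htK (htK.isChannel htK1).trace_preserving
    (codeMatrix_conjTranspose_mul_self hm x) fun e f => ?_
  rw [tensorMatrix_conjTranspose, tensorMatrix_mul]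
  exact exists_codeMatrix_compression_eq_smul hm x fun i => hKL _ _

theorem finrank_range_toEuclideanLin {A κ : Type*} [Fintype A] [Fintype κ] [DecidableEq κ]
    {P : Matrix A κ ℂ} (hP : Pᴴ * P = 1) :
    Module.finrank ℂ (LinearMap.range (toEuclideanLin P)) = Fintype.card κ := by
  rw [LinearMap.finrank_range_of_inj, finrank_euclideanSpace]
  intro v w hvw
  have h1 : P *ᵥ v.ofLp = P *ᵥ w.ofLp := by
    simpa [toLpLin_apply] using congrArg WithLp.ofLp hvw
  have h2 := congrArg (Pᴴ *ᵥ ·) h1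
  simp only [mulVec_mulVec, hP, one_mulVec] at h2
  exact WithLp.ofLp_injective 2 h2

theorem isOrtho_range_toEuclideanLin {A κ ι : Type*} [Fintype A] [Fintype κ] [DecidableEq κ]
    [Fintype ι] [DecidableEq ι] {P : Matrix A κ ℂ} {Q : Matrix A ι ℂ} (hPQ : Pᴴ * Q = 0) :
    LinearMap.range (toEuclideanLin P) ⟂ LinearMap.range (toEuclideanLin Q) := by
  rw [Submodule.isOrtho_iff_inner_eq]
  rintro _ ⟨v, rfl⟩ _ ⟨w, rfl⟩
  rw [EuclideanSpace.inner_eq_star_dotProduct, dotProduct_comm]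
  simp only [toLpLin_apply]
  rw [star_mulVec, dotProduct_mulVec, vecMul_vecMul, hPQ, vecMul_zero, zero_dotProduct]

/-! ### The angle `θ_n` -/

/-- Up to the minimal solution `θ_n`, the left-hand side of the equation for `θ_n` is bounded by the
right-hand side. -/
theorem le_of_le_theta {p n : ℕ} (hn : 1 ≤ n) {θ : ℝ} (hθ : 0 < θ) (hle : θ ≤ theta p n) :
    2 * (1 - Real.cos (θ / 2)) + delta p * Real.sin (θ / 2) ≤ (n : ℝ)⁻¹ * Real.log (3 / 2) := by
  by_contra! hlt
  set c : ℝ := (n : ℝ)⁻¹ * Real.log (3 / 2) with hc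
  have hn0 : (0 : ℝ) < n := by exact_mod_cast hn
  have hc0 : 0 < c := mul_pos (inv_pos.2 hn0) (Real.log_pos (by norm_num))
  let f : ℝ → ℝ := fun θ => 2 * (1 - Real.cos (θ / 2)) + delta p * Real.sin (θ / 2)
  have hcont : Continuous f := by fun_prop
  obtain ⟨t, ht, hft⟩ := intermediate_value_Ioo hθ.le hcont.continuousOn
    (show c ∈ Set.Ioo (f 0) (f θ) from ⟨by simpa [f] using hc0, hlt⟩)
  have := (isLeast_theta p n hn).2 ⟨ht.1, hft⟩
  linarith [ht.2]

end QZE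

end

theorem corollary3 (p n m : ℕ) (hp : 2 ≤ p) (hn : 1 ≤ n) (hm : 1 ≤ m)
    (hmn : Real.pi / (m : ℝ) ≤ QZE.theta p n)
    {B : Type*} [Fintype B]
    (Φ : Matrix (Fin (2 ^ p)) (Fin (2 ^ p)) ℂ →ₗ[ℂ] Matrix B B ℂ) (hΦ : QZE.IsChannel Φ)
    (hgraph : QZE.HasNoncommutativeGraph Φ (QZE.deformed p (Real.pi / (m : ℝ)))) :
    QZE.oneShotCapacity (QZE.tensorPower n Φ) = 0 ∧
    (p : ℝ) - 1 ≤ QZE.oneShotCapacity (QZE.tensorPower m Φ) ∧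
    ((p : ℝ) - 1) / (m : ℝ) ≤ QZE.zeroErrorCapacity Φ ∧
    ∃ C : Fin (2 ^ m) → Submodule ℂ (EuclideanSpace ℂ (Fin m → Fin (2 ^ p))),
      (∀ i, QZE.IsErrorCorrectingCode (QZE.tensorPower m Φ) (C i) ∧
        Module.finrank ℂ (C i) = 2 ^ (p - 1)) ∧
      ∀ i j, i ≠ j → C i ⟂ C j := by
  obtain ⟨q, rfl⟩ : ∃ q, p = q + 1 := ⟨p - 1, by omega⟩
  have hm0 : (0 : ℝ) < m := by exact_mod_cast hm
  have hn0 : (0 : ℝ) < n := by exact_mod_cast hn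
  let C : (Fin m → Bool) → Submodule ℂ (EuclideanSpace ℂ (Fin m → Fin (2 ^ (q + 1)))) :=
    fun x => LinearMap.range (Matrix.toEuclideanLin (QZE.codeMatrix q x))
  have hcode : ∀ x, QZE.IsErrorCorrectingCode (QZE.tensorPower m Φ) (C x) := fun x =>
    QZE.isErrorCorrectingCode_range_codeMatrix hm hgraph x
  have hrank : ∀ x, Module.finrank ℂ (C x) = 2 ^ q := fun x => by
    rw [QZE.finrank_range_toEuclideanLin (QZE.codeMatrix_conjTranspose_mul_self hm x),
      Fintype.card_fin]
  have hcap : ((q + 1 : ℕ) : ℝ) - 1 ≤ QZE.oneShotCapacity (QZE.tensorPower m Φ) := by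
    refine le_csSup (QZE.bddAbove_codeRates _) ⟨C fun _ => false, ?_, hcode _, ?_⟩
    · intro h
      have h1 := hrank fun _ => false
      rw [h, finrank_bot] at h1
      exact absurd h1.symm (by positivity)
    · rw [hrank]
      push_cast
      rw [Real.logb_pow, Real.logb_self_eq_one (by norm_num)]
      ring
  refine ⟨?_, hcap, ?_, ?_⟩
  · obtain ⟨κ, _, h, hh, hmem⟩ := QZE.exists_isParseval_undeformed (q + 1)
    have hθ : 0 < Real.pi / (m : ℝ) := by positivity
    have hθπ : Real.pi / (m : ℝ) ≤ Real.pi := div_le_self Real.pi_pos.le (by exact_mod_cast hm)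
    have hsin : 0 ≤ Real.sin (Real.pi / (m : ℝ) / 2) :=
      Real.sin_nonneg_of_nonneg_of_le_pi (by linarith) (by linarith)
    have hc0 : 0 < (n : ℝ)⁻¹ * Real.log (3 / 2) :=
      mul_pos (inv_pos.2 hn0) (Real.log_pos (by norm_num))
    refine QZE.oneShotCapacity_tensorPower_eq_zero hgraph hh (fun k => ⟨_, hmem k, rfl⟩)
      ((QZE.schurBound_deformation q _ hsin).mono (QZE.le_of_le_theta hn hθ hmn)) ?_
    -- `(1 + c)ⁿ < exp (c n) = 3/2` for `c = ln (3/2) / n`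
    have h1 : (1 + (n : ℝ)⁻¹ * Real.log (3 / 2)) ^ n < 3 / 2 := by
      have h2 : 1 + (n : ℝ)⁻¹ * Real.log (3 / 2) < Real.exp ((n : ℝ)⁻¹ * Real.log (3 / 2)) := by
        linarith [Real.add_one_lt_exp hc0.ne']
      have h3 := pow_lt_pow_left₀ h2 (by positivity) (by omega : n ≠ 0)
      rwa [← Real.exp_nat_mul, mul_inv_cancel_left₀ hn0.ne', Real.exp_log (by norm_num)] at h3
    linarith
  · refine le_trans ?_ (le_csSup (QZE.bddAbove_nShotRates Φ) ⟨m, hm, rfl⟩)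
    rw [div_eq_inv_mul]
    exact mul_le_mul_of_nonneg_left hcap (inv_nonneg.2 hm0.le)
  · let e : Fin (2 ^ m) ≃ (Fin m → Bool) := (Fintype.equivFinOfCardEq (by simp)).symm
    refine ⟨fun i => C (e i), fun i => ⟨hcode _, hrank _⟩, fun i j hij => ?_⟩
    exact QZE.isOrtho_range_toEuclideanLin
      (QZE.codeMatrix_conjTranspose_mul_of_ne (e.injective.ne hij))
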